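/- **Setting.** For $\varphi\in L^1(\mathbb R)$ let $\hat\varphi(x)=\int\varphi(s)e^{-2\pi i sx}\,ds$. Let $\Phi$ be a complex Gaussian white noise on a probability space: a linear map from the Schwartz space $\mathcal S(\mathbb R;\mathbb C)$ to complex random variables, continuous in the sense of finite-dimensional distributions, whose finite-dimensional distributions are jointly Gaussian with mean zero and $$\mathbb E[\Phi(\varphi)\overline{\Phi(\chi)}]=\int\hat\varphi(x)\overline{\hat\chi(x)}\,dx,\qquad \mathbb E[\Phi(\varphi)\Phi(\chi)]=\int\hat\varphi(x)\hat\chi(-x)\,dx .$$ Let $f(s)=Ae^{2\pi i\xi_0 s}$ with $A\ge 0$, $\xi_0>0$. For a Schwartz window $k$, $t\in\mathbb R$ and $\eta>0$ put $k_{t,\eta}(s)=k(s-t)e^{-2\pi i\eta(s-t)}$ and $$V^{(k)}(t,\eta)=\int f\,k_{t,\eta}+\Phi(k_{t,\eta}),\qquad \partial_tV^{(k)}(t,\eta)=\int f\,\partial_tk_{t,\eta}+\Phi(\partial_tk_{t,\eta}),\qquad \Omega^{(k)}(t,\eta)=\frac{1}{2\pi i}\frac{\partial_tV^{(k)}(t,\eta)}{V^{(k)}(t,\eta)},$$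 $$Y^{(k,\alpha,\xi)}(t,\eta)=V^{(k)}(t,\eta)\,\frac1{\pi\alpha}\exp\Big(-\frac1\alpha\big|\xi-\Omega^{(k)}(t,\eta)\big|^2\Big)$$ (read as $0$ where $V^{(k)}(t,\eta)=0$). Let $h(x)=(2\pi)^{-1/2}e^{-x^2/2}$. For $M>0$ let $\psi\in C_c^\infty(\mathbb R;\mathbb R)$ be even, with $\psi(x)=1$ for $|x|\le M$, $\psi(x)=0$ for $|x|>2M$, and non-increasing on $[M,2M]$; let $\mathsf h=\mathcal F^{-1}(\hat h\psi)$. Write $Y_{\alpha,\eta}=Y^{(h,\alpha,\xi)}(t,\eta)$ and $\mathsf Y_{\alpha,\eta}=Y^{(\mathsf h,\alpha,\xi)}(t,\eta)$. For complex random variables, $\mathrm{Var}(X)=\mathbb E|X-\mathbb EX|^2$ and $\mathrm{Cov}(X,Z)=\mathbb E[(X-\mathbb EX)\overline{(Z-\mathbb EZ)}]$. **Lemma (Main Lemma 2 for Kernel SST).** Fix $A\ge0$, $\xi_0>0$ and $\xi>0$. There are $\alpha_0,M_0,R>0$ and functions $C(\eta)$ and $K(\eta,\eta')$, all depending only on $A,\xi_0,\xi$,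 such that for every such $\Phi$, all $t\in\mathbb R$, all $0<\alpha\le\alpha_0$, all $M\ge M_0$ and every $\psi$ as above, all $Y_{\alpha,\eta}$ and $\mathsf Y_{\alpha,\eta}$ ($\eta>0$) are square-integrable and: 1. for all $\eta>0$, $$|\mathrm{Var}(Y_{\alpha,\eta})-\mathrm{Cov}(Y_{\alpha,\eta},\mathsf Y_{\alpha,\eta})|\le C(\eta)\,\alpha^{-5}e^{-3M^2},\qquad |\mathrm{Var}(\mathsf Y_{\alpha,\eta})-\mathrm{Cov}(\mathsf Y_{\alpha,\eta},Y_{\alpha,\eta})|\le C(\eta)\,\alpha^{-5}e^{-3M^2},$$ where $C(\eta)=O(\eta^{-1/2})$ as $\eta\to0^+$; 2. for all $\eta,\eta'>0$ with $|\eta-\eta'|\ge R$, $$|\mathrm{Cov}(Y_{\alpha,\eta},Y_{\alpha,\eta'})-\mathrm{Cov}(\mathsf Y_{\alpha,\eta},Y_{\alpha,\eta'})|\le K(\eta,\eta')\,\alpha^{-5}e^{-3M^2},$$ $$|\mathrm{Cov}(\mathsf Y_{\alpha,\eta},\mathsf Y_{\alpha,\eta'})-\mathrm{Cov}(Y_{\alpha,\eta},\mathsf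 Y_{\alpha,\eta'})|\le K(\eta,\eta')\,\alpha^{-5}e^{-3M^2},$$ where, over all pairs $\eta,\eta'>0$ with $|\eta-\eta'|\ge R$: for every $\delta>0$, $K(\eta,\eta')=O(e^{-(\eta-\eta')^2})$ uniformly over $\eta,\eta'\ge\delta$; and for some $\delta>0$, $K(\eta,\eta')=O(\eta^{-1/2}e^{-(\eta-\eta')^2})$ uniformly over $\eta<\delta$ and $K(\eta,\eta')=O(\eta'^{-1/2}e^{-(\eta-\eta')^2})$ uniformly over $\eta'<\delta$. -/

import Mathlib

open MeasureTheory ProbabilityTheory Filter Topology Asymptotics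
open scoped SchwartzMap FourierTransform ComplexConjugate

noncomputable section

namespace SST

/-! ### The Gaussian window as a Schwartz function -/

theorem exists_bound_pow_mul_exp (m : ℕ) :
    ∃ C : ℝ, ∀ x : ℝ, |x| ^ m * Real.exp (-(x ^ 2 / 2)) ≤ C := by
  refine ⟨1 + 2 ^ m * (Nat.factorial m : ℝ), fun x => ?_⟩
  have h1 : |x| ^ m ≤ 1 + (x ^ 2) ^ m := by
    rcases le_total |x| 1 with h | h
    · have : |x| ^ m ≤ 1 := pow_le_one₀ (abs_nonneg x) h
      have : 0 ≤ (x ^ 2) ^ m := by positivity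
      linarith
    · have h2 : |x| ^ m ≤ (|x| ^ 2) ^ m := by
        gcongr
        nlinarith
      rw [sq_abs] at h2
      linarith
  have h3 : (x ^ 2 / 2) ^ m / (Nat.factorial m : ℝ) ≤ Real.exp (x ^ 2 / 2) :=
    Real.pow_div_factorial_le_exp _ (by positivity) m
  have hf : (0 : ℝ) < (Nat.factorial m : ℝ) := by exact_mod_cast Nat.factorial_pos m
  have h4 : (x ^ 2) ^ m * Real.exp (-(x ^ 2 / 2)) ≤ 2 ^ m * (Nat.factorial m : ℝ) := by
    rw [Real.exp_neg, ← div_eq_mul_inv, div_le_iff₀ (Real.exp_pos _)]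
    rw [div_pow, div_div, div_le_iff₀ (by positivity)] at h3
    linarith
  have h5 : Real.exp (-(x ^ 2 / 2)) ≤ 1 := Real.exp_le_one_iff.mpr (by nlinarith [sq_nonneg x])
  calc |x| ^ m * Real.exp (-(x ^ 2 / 2))
      ≤ (1 + (x ^ 2) ^ m) * Real.exp (-(x ^ 2 / 2)) := by gcongr
    _ ≤ _ := by linarith

theorem exists_bound_poly_mul_exp (p : Polynomial ℝ) (k : ℕ) :
    ∃ C : ℝ, ∀ x : ℝ, |x| ^ k * |p.eval x * Real.exp (-(x ^ 2 / 2))| ≤ C := by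
  induction p using Polynomial.induction_on' with
  | add p q hp hq =>
    obtain ⟨C, hC⟩ := hp
    obtain ⟨D, hD⟩ := hq
    refine ⟨C + D, fun x => ?_⟩
    rw [Polynomial.eval_add, add_mul]
    calc _ ≤ |x| ^ k * (|p.eval x * Real.exp (-(x ^ 2 / 2))|
            + |q.eval x * Real.exp (-(x ^ 2 / 2))|) := by
          gcongr
          exact abs_add_le _ _
      _ ≤ C + D := by rw [mul_add]; exact add_le_add (hC x) (hD x)
  | monomial n a =>
    obtain ⟨C, hC⟩ := exists_bound_pow_mul_exp (k + n)
    refine ⟨|a| * C, fun x => ?_⟩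
    rw [Polynomial.eval_monomial, abs_mul, abs_mul, abs_pow, abs_of_pos (Real.exp_pos _)]
    calc _ = |a| * (|x| ^ (k + n) * Real.exp (-(x ^ 2 / 2))) := by ring
      _ ≤ _ := by gcongr; exact hC x

/-- `x ↦ e^{-x²/2}` as a real Schwartz function. -/
def gaussianSchwartz : 𝓢(ℝ, ℝ) where
  toFun x := Real.exp (-(x ^ 2 / 2))
  smooth' := by fun_prop
  decay' k n := by
    obtain ⟨C, hC⟩ :=
      exists_bound_poly_mul_exp ((Polynomial.hermite n).map (Int.castRingHom ℝ)) k
    refine ⟨C, fun x => le_trans (le_of_eq ?_) (hC x)⟩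
    rw [norm_iteratedFDeriv_eq_norm_iteratedDeriv, iteratedDeriv_eq_iterate,
      Polynomial.deriv_gaussian_eq_hermite_mul_gaussian, Real.norm_eq_abs, Real.norm_eq_abs,
      mul_assoc, abs_mul ((-1) ^ n), abs_pow, abs_neg, abs_one, one_pow, one_mul,
      Polynomial.aeval_def, Polynomial.eval_map, algebraMap_int_eq]

/-- The window `h(x) = (2π)^{-1/2} e^{-x²/2}`. -/
def gaussianWindow : 𝓢(ℝ, ℂ) :=
  (((Real.sqrt (2 * Real.pi))⁻¹ : ℝ) : ℂ) •
    SchwartzMap.postcompCLM Complex.ofRealCLM gaussianSchwartz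

theorem gaussianWindow_apply (x : ℝ) :
    gaussianWindow x = (((Real.sqrt (2 * Real.pi))⁻¹ * Real.exp (-(x ^ 2 / 2)) : ℝ) : ℂ) := by
  have h : gaussianWindow x = (((Real.sqrt (2 * Real.pi))⁻¹ : ℝ) : ℂ) *
      ((Real.exp (-(x ^ 2 / 2)) : ℝ) : ℂ) := rfl
  rw [h, ← Complex.ofReal_mul]

/-! ### Time-frequency shifts of a Schwartz function -/

theorem iteratedDeriv_cexp_real (c : ℂ) (n : ℕ) :
    iteratedDeriv n (fun s : ℝ => Complex.exp (c * s)) =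
      fun s : ℝ => c ^ n * Complex.exp (c * s) := by
  induction n with
  | zero => simp
  | succ n ih =>
    rw [iteratedDeriv_succ, ih]
    funext s
    have h : HasDerivAt (fun s : ℝ => c * (s : ℂ)) c s := by
      simpa using (Complex.ofRealCLM.hasDerivAt (x := s)).const_mul c
    rw [(h.cexp.const_mul (c ^ n)).deriv]
    ring

theorem hasTemperateGrowth_modulation (η : ℝ) :
    (fun s : ℝ => Complex.exp (-2 * Real.pi * Complex.I * η * s)).HasTemperateGrowth := by
  refine ⟨Complex.contDiff_exp.comp (contDiff_const.mul Complex.ofRealCLM.contDiff), fun n => ⟨0, ‖(-2 * Real.pi * Complex.I * η : ℂ)‖ ^ n, fun s => ?_⟩⟩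
  rw [norm_iteratedFDeriv_eq_norm_iteratedDeriv, iteratedDeriv_cexp_real, norm_mul, norm_pow]
  have : ‖Complex.exp (-2 * Real.pi * Complex.I * η * s)‖ = 1 := by
    have h : (-2 * Real.pi * Complex.I * η * s : ℂ)
        = ((-2 * Real.pi * η * s : ℝ) : ℂ) * Complex.I := by push_cast; ring
    rw [h, Complex.norm_exp_ofReal_mul_I]
  rw [this]
  simp

/-- `h_{t,η}(s) = h(s - t) e^{-2πiη(s - t)}`. -/
def shift (h : 𝓢(ℝ, ℂ)) (t η : ℝ) : 𝓢(ℝ, ℂ) :=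
  SchwartzMap.compSubConstCLM ℂ t
    (SchwartzMap.smulLeftCLM ℂ
      (fun s : ℝ => Complex.exp (-2 * Real.pi * Complex.I * η * s)) h)

theorem shift_apply (h : 𝓢(ℝ, ℂ)) (t η s : ℝ) :
    shift h t η s =
      h (s - t) * Complex.exp (-2 * Real.pi * Complex.I * η * ((s - t : ℝ) : ℂ)) := by
  rw [shift, SchwartzMap.compSubConstCLM_apply,
    SchwartzMap.smulLeftCLM_apply_apply (hasTemperateGrowth_modulation η), smul_eq_mul, mul_comm]

/-- The `t`-derivative of `h_{t,η}`, namely `∂_t h_{t,η} = -(h')_{t,η} + 2πiη h_{t,η}`. -/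
def shiftDeriv (h : 𝓢(ℝ, ℂ)) (t η : ℝ) : 𝓢(ℝ, ℂ) :=
  -shift (SchwartzMap.derivCLM ℂ ℂ h) t η + (2 * Real.pi * Complex.I * η : ℂ) • shift h t η

theorem hasDerivAt_shift (h : 𝓢(ℝ, ℂ)) (t η s : ℝ) :
    HasDerivAt (fun t' : ℝ => shift h t' η s) (shiftDeriv h t η s) t := by
  have h1 : HasDerivAt (fun t' : ℝ => s - t') (-1) t := by
    simpa using (hasDerivAt_id t).const_sub s
  have h2 : HasDerivAt (fun t' : ℝ => h (s - t')) (-(deriv h (s - t))) t := by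
    have := (h.differentiableAt (x := s - t)).hasDerivAt.scomp t h1
    refine this.congr_deriv ?_
    simp
  have h3 : HasDerivAt
      (fun t' : ℝ => -2 * Real.pi * Complex.I * η * ((s - t' : ℝ) : ℂ))
      (2 * Real.pi * Complex.I * η) t := by
    have := (h1.ofReal_comp).const_mul (-2 * Real.pi * Complex.I * η : ℂ)
    refine this.congr_deriv ?_
    push_cast
    ring
  have h4 := h2.mul h3.cexp
  have h5 : (fun t' : ℝ => shift h t' η s) = fun t' : ℝ =>
      h (s - t') * Complex.exp (-2 * Real.pi * Complex.I * η * ((s - t' : ℝ) : ℂ)) := by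
    funext t'
    exact shift_apply h t' η s
  rw [h5]
  refine h4.congr_deriv ?_
  have h6 : shiftDeriv h t η s = -(shift (SchwartzMap.derivCLM ℂ ℂ h) t η s)
      + (2 * Real.pi * Complex.I * η : ℂ) * shift h t η s := rfl
  rw [h6, shift_apply, shift_apply, SchwartzMap.derivCLM_apply]
  ring

/-! ### The `M`-dependent truncation of a window -/

/-- `ψ` is a smooth even cutoff, equal to `1` on `|t| ≤ M`, decreasing in `|t|` on `[M, 2M]` and
equal to `0` for `|t| > 2M`. -/
structure IsCutoff (M : ℝ) (ψ : ℝ → ℝ) : Prop where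
  contDiff : ContDiff ℝ (⊤ : ℕ∞) ψ
  even : ∀ t, ψ (-t) = ψ t
  antitoneOn : AntitoneOn ψ (Set.Icc M (2 * M))
  eq_one : ∀ t, |t| ≤ M → ψ t = 1
  eq_zero : ∀ t, 2 * M < |t| → ψ t = 0

theorem IsCutoff.hasTemperateGrowth {M : ℝ} {ψ : ℝ → ℝ} (hψ : IsCutoff M ψ) :
    (fun x : ℝ => (ψ x : ℂ)).HasTemperateGrowth := by
  have hc : HasCompactSupport (fun x : ℝ => (ψ x : ℂ)) := by
    refine HasCompactSupport.of_support_subset_isCompact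
      (isCompact_Icc (a := -(2 * M)) (b := 2 * M)) fun x hx => ?_
    by_contra hx'
    refine hx ?_
    have : 2 * M < |x| := by
      by_contra hle
      exact hx' (abs_le.mp (not_lt.mp hle))
    simp [hψ.eq_zero x this]
  have hs : ContDiff ℝ (⊤ : ℕ∞) (fun x : ℝ => (ψ x : ℂ)) := Complex.ofRealCLM.contDiff.comp hψ.contDiff
  exact (hc.toSchwartzMap hs).hasTemperateGrowth

/-- The truncated window `𝓕⁻¹(ψ · 𝓕 h)`, for a cutoff `ψ`. -/
def truncatedWindow (ψ : ℝ → ℝ) (h : 𝓢(ℝ, ℂ)) : 𝓢(ℝ, ℂ) :=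
  𝓕⁻ (SchwartzMap.smulLeftCLM ℂ (fun x : ℝ => (ψ x : ℂ)) (𝓕 h))

theorem fourier_truncatedWindow {M : ℝ} {ψ : ℝ → ℝ} (hψ : IsCutoff M ψ) (h : 𝓢(ℝ, ℂ)) (x : ℝ) :
    (𝓕 (truncatedWindow ψ h) : 𝓢(ℝ, ℂ)) x = ψ x * (𝓕 h : 𝓢(ℝ, ℂ)) x := by
  rw [truncatedWindow, FourierTransform.fourier_fourierInv_eq,
    SchwartzMap.smulLeftCLM_apply_apply hψ.hasTemperateGrowth, smul_eq_mul]

/-! ### Complex Gaussian white noise -/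

variable {Ω : Type*} [MeasurableSpace Ω]

/-- A generalized random process: an (almost surely) linear family of random variables indexed by
Schwartz functions, continuous in the sense of finite-dimensional distributions. -/
structure IsGRP (Φ : 𝓢(ℝ, ℂ) → Ω → ℂ) (P : Measure Ω) [IsProbabilityMeasure P] : Prop where
  aemeasurable : ∀ φ, AEMeasurable (Φ φ) P
  map_add : ∀ φ χ, Φ (φ + χ) =ᵐ[P] Φ φ + Φ χ
  map_smul : ∀ (c : ℂ) φ, Φ (c • φ) =ᵐ[P] c • Φ φ
  continuous_fdd : ∀ (n : ℕ) (φ : ℕ → Fin n → 𝓢(ℝ, ℂ)) (φ' : Fin n → 𝓢(ℝ, ℂ)),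
    Tendsto φ atTop (𝓝 φ') →
      TendstoInDistribution (fun k ω i => Φ (φ k i) ω) atTop (fun ω i => Φ (φ' i) ω)
        (fun _ => P) P

/-- Complex Gaussian white noise: a GRP with jointly (complex, possibly improper) Gaussian
finite-dimensional distributions, mean zero, and power spectrum the Lebesgue measure, that is
`E[Φ(φ) conj Φ(χ)] = ∫ φ̂(x) conj χ̂(x) dx` and `E[Φ(φ) Φ(χ)] = ∫ φ̂(x) χ̂(-x) dx`.
The finite-dimensional distributions are determined by these data, and are invariant under
translations; thus `Φ` is stationary. -/
structure IsComplexGaussianWhiteNoise (Φ : 𝓢(ℝ, ℂ) → Ω → ℂ) (P : Measure Ω)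
    [IsProbabilityMeasure P] : Prop extends IsGRP Φ P where
  gaussian : ∀ (n : ℕ) (φ : Fin n → 𝓢(ℝ, ℂ)), HasGaussianLaw (fun ω i => Φ (φ i) ω) P
  mean_zero : ∀ φ, ∫ ω, Φ φ ω ∂P = 0
  cov : ∀ φ χ : 𝓢(ℝ, ℂ),
    ∫ ω, Φ φ ω * conj (Φ χ ω) ∂P = ∫ x : ℝ, (𝓕 φ : 𝓢(ℝ, ℂ)) x * conj ((𝓕 χ : 𝓢(ℝ, ℂ)) x)
  pseudocov : ∀ φ χ : 𝓢(ℝ, ℂ),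
    ∫ ω, Φ φ ω * Φ χ ω ∂P = ∫ x : ℝ, (𝓕 φ : 𝓢(ℝ, ℂ)) x * (𝓕 χ : 𝓢(ℝ, ℂ)) (-x)

/-! ### Short-time Fourier transform, reassignment rule and SST integrand -/

/-- The signal `f(s) = A e^{2πiξ₀s}`. -/
def signal (A ξ₀ : ℝ) (s : ℝ) : ℂ := A * Complex.exp (2 * Real.pi * Complex.I * ξ₀ * s)

/-- The random tempered distribution `f + Φ`, evaluated at a Schwartz function. -/
def observe (f : ℝ → ℂ) (Φ : 𝓢(ℝ, ℂ) → Ω → ℂ) (φ : 𝓢(ℝ, ℂ)) (ω : Ω) : ℂ :=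
  (∫ s : ℝ, f s * φ s) + Φ φ ω

/-- `V_{f+Φ}^{(h)}(t,η) = (f + Φ)(h_{t,η})`. -/
def stft (f : ℝ → ℂ) (Φ : 𝓢(ℝ, ℂ) → Ω → ℂ) (h : 𝓢(ℝ, ℂ)) (t η : ℝ) : Ω → ℂ :=
  observe f Φ (shift h t η)

/-- `∂_t V_{f+Φ}^{(h)}(t,η) = (f + Φ)(∂_t h_{t,η})`. -/
def stftDeriv (f : ℝ → ℂ) (Φ : 𝓢(ℝ, ℂ) → Ω → ℂ) (h : 𝓢(ℝ, ℂ)) (t η : ℝ) : Ω → ℂ :=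
  observe f Φ (shiftDeriv h t η)

/-- The reassignment rule `(2πi)⁻¹ ∂_t V / V`. Its value where `V = 0` is irrelevant, as it is used
only through `sstIntegrand`, which vanishes there. -/
def reassignment (f : ℝ → ℂ) (Φ : 𝓢(ℝ, ℂ) → Ω → ℂ) (h : 𝓢(ℝ, ℂ)) (t η : ℝ) (ω : Ω) : ℂ :=
  1 / (2 * Real.pi * Complex.I) * (stftDeriv f Φ h t η ω / stft f Φ h t η ω)

/-- `g_α(z) = (πα)⁻¹ e^{-|z|²/α}`. -/
def approxDelta (α : ℝ) (z : ℂ) : ℝ := 1 / (Real.pi * α) * Real.exp (-(‖z‖ ^ 2 / α))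

/-- The SST integrand `Y_{f+Φ}^{(h,α,ξ)}(t,η) = V(t,η) g_α(ξ - Ω(t,η))`. -/
def sstIntegrand (f : ℝ → ℂ) (Φ : 𝓢(ℝ, ℂ) → Ω → ℂ) (h : 𝓢(ℝ, ℂ)) (α ξ t η : ℝ) (ω : Ω) : ℂ :=
  stft f Φ h t η ω * (approxDelta α ((ξ : ℂ) - reassignment f Φ h t η ω) : ℂ)

/-- `Y_{α,η}`: the SST integrand of `f + Φ` for the Gaussian window. -/
def Y (A ξ₀ : ℝ) (Φ : 𝓢(ℝ, ℂ) → Ω → ℂ) (ξ t α η : ℝ) : Ω → ℂ :=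
  sstIntegrand (signal A ξ₀) Φ gaussianWindow α ξ t η

/-- The truncated `Y_{α,η}`: the SST integrand of `f + Φ` for the truncated Gaussian window. -/
def Ytrunc (ψ : ℝ → ℝ) (A ξ₀ : ℝ) (Φ : 𝓢(ℝ, ℂ) → Ω → ℂ) (ξ t α η : ℝ) : Ω → ℂ :=
  sstIntegrand (signal A ξ₀) Φ (truncatedWindow ψ gaussianWindow) α ξ t η

/-! ### Variance and covariance of complex random variables -/

/-- `Var(X) = E|X - EX|²`. -/
def complexVar (X : Ω → ℂ) (P : Measure Ω) : ℝ := ∫ ω, ‖X ω - ∫ ω', X ω' ∂P‖ ^ 2 ∂P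

/-- `Cov(X, Y) = E[(X - EX) conj(Y - EY)]`. -/
def complexCov (X Y : Ω → ℂ) (P : Measure Ω) : ℂ :=
  ∫ ω, (X ω - ∫ ω', X ω' ∂P) * conj (Y ω - ∫ ω', Y ω' ∂P) ∂P

end SST

end

/-! Put `a = ξ - η`. Since `∂_t V / (2πi V) = η + U / V`, where `U` is the transform with window
`-(2πi)⁻¹ κ'`, the integrand is almost surely `profile a α V U`, and `η` enters only through `a` and
the frequency shift. Two bounds on the profile, both valid for `α ≤ 1`, carry the proof: it is at
most `α⁻¹ (‖v‖ + ‖u‖) / (1 + |a|)`, and it is Lipschitz, across `v = 0` too, with constant `α⁻² (1 +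
|a|)`. By Cauchy–Schwarz, perturbing the window at `η` in a covariance with the integrand at `η'`
therefore costs the ratio `(1 + |ξ - η|) / (1 + |ξ - η'|) ≤ 1 + |η - η'|`, times `α⁻³` and the size
of the perturbation.

The transform of the Gaussian window is `e^{-2π²x²} ≤ e^{-19x²}`. Cutting it off at `M` is thus a
perturbation of size `e^{-18M²}`, which already settles the variances. For the covariances put `Δ =
η - η'`. Cutting both windows off at `|Δ| / 2` separates their spectra; the covariance and the
pseudo-covariance then vanish, and joint Gaussianity gives independence. So each covariance is
itself `O((1 + |Δ|) e^{-2Δ²})`. The perturbation bound is used when `2Δ² ≤ 15M²` and this decay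
otherwise; both give `e^{-Δ²} e^{-3M²}` (`norm_complexCov_sub_complexCov_le`). -/

namespace SST

/-! ### The reassignment profile -/

/-- The function `(v, u) ↦ v g_α(a - u / v)`. -/
noncomputable def profile (a α : ℝ) (v u : ℂ) : ℂ := v * (approxDelta α ((a : ℂ) - u / v) : ℂ)

theorem measurable_profile (a α : ℝ) : Measurable fun p : ℂ × ℂ => profile a α p.1 p.2 := by
  unfold profile approxDelta
  fun_prop

/-- By the mean value theorem the difference is `(2c/α) e^{-c²/α} (q - p)` with `p < c < q`. Both
estimates then follow from `e^{-y}(y + 1) ≤ 1` at `y = c²/α`. The version weighted by `p` has no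
factor `1/α`; it later absorbs a factor `‖z‖`. -/
theorem exp_neg_sq_div_sub_le {α p q : ℝ} (hα : 0 < α) (hα1 : α ≤ 1) (hp : 0 ≤ p) (hpq : p ≤ q) :
    Real.exp (-(p ^ 2 / α)) - Real.exp (-(q ^ 2 / α)) ≤ 1 / α * (q - p) ∧
      p * (Real.exp (-(p ^ 2 / α)) - Real.exp (-(q ^ 2 / α))) ≤ 2 * (q - p) := by
  rcases hpq.eq_or_lt with rfl | hlt
  · simp
  have hd : ∀ s : ℝ, HasDerivAt (fun s : ℝ => Real.exp (-(s ^ 2 / α)))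
      (Real.exp (-(s ^ 2 / α)) * (-(2 * s / α))) s := fun s => by
    have := (((hasDerivAt_pow 2 s).div_const α).neg).exp
    simpa using this
  obtain ⟨c, ⟨hpc, hcq⟩, hc⟩ := exists_hasDerivAt_eq_slope _ _ hlt
    (fun s _ => (hd s).continuousAt.continuousWithinAt) (fun s _ => hd s)
  have hqp : 0 < q - p := sub_pos.2 hlt
  have hdiff : Real.exp (-(p ^ 2 / α)) - Real.exp (-(q ^ 2 / α))
      = Real.exp (-(c ^ 2 / α)) * (2 * c / α) * (q - p) := by
    rw [eq_div_iff hqp.ne'] at hc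
    linarith
  have hc0 : 0 < c := hp.trans_lt hpc
  have hle : Real.exp (-(c ^ 2 / α)) * (c ^ 2 / α + 1) ≤ 1 := by
    rw [Real.exp_neg, inv_mul_le_iff₀ (Real.exp_pos _), mul_one]
    exact Real.add_one_le_exp _
  have hsq : c ^ 2 ≤ c ^ 2 / α := by
    rw [le_div_iff₀ hα]
    nlinarith [sq_nonneg c]
  have hE := Real.exp_pos (-(c ^ 2 / α))
  have h1 : Real.exp (-(c ^ 2 / α)) * (2 * c) ≤ 1 :=
    le_trans (mul_le_mul_of_nonneg_left (by nlinarith [sq_nonneg (c - 1)]) hE.le) hle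
  have h2 : Real.exp (-(c ^ 2 / α)) * (c ^ 2 / α) ≤ 1 :=
    le_trans (mul_le_mul_of_nonneg_left (by linarith) hE.le) hle
  rw [hdiff]
  constructor
  · gcongr
    calc _ = (Real.exp (-(c ^ 2 / α)) * (2 * c)) / α := by ring
      _ ≤ 1 / α := by gcongr
  · rw [← mul_assoc]
    gcongr
    calc p * (Real.exp (-(c ^ 2 / α)) * (2 * c / α))
        ≤ c * (Real.exp (-(c ^ 2 / α)) * (2 * c / α)) := by gcongr
      _ = 2 * (Real.exp (-(c ^ 2 / α)) * (c ^ 2 / α)) := by ring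
      _ ≤ 2 := by linarith

theorem norm_profile {a α : ℝ} (hα : 0 < α) (v u : ℂ) :
    ‖profile a α v u‖ =
      1 / (Real.pi * α) * (‖v‖ * Real.exp (-(‖(a : ℂ) - u / v‖ ^ 2 / α))) := by
  rw [profile, norm_mul, Complex.norm_real, approxDelta, Real.norm_of_nonneg (by positivity)]
  ring

/-- The profile decays like `(1 + |a|)⁻¹`. -/
theorem norm_profile_le {a α : ℝ} (hα : 0 < α) (hα1 : α ≤ 1) (v u : ℂ) :
    (1 + |a|) * ‖profile a α v u‖ ≤ α⁻¹ * (‖v‖ + ‖u‖) := by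
  rw [norm_profile hα]
  set z : ℂ := (a : ℂ) - u / v with hz
  set E := Real.exp (-(‖z‖ ^ 2 / α)) with hE
  have hE0 : 0 < E := Real.exp_pos _
  have hE1 : E ≤ 1 := Real.exp_le_one_iff.2 (by simp; positivity)
  have hzE : ‖z‖ * E ≤ 1 := by
    have h1 : E * (‖z‖ ^ 2 / α + 1) ≤ 1 := by
      rw [hE, Real.exp_neg, inv_mul_le_iff₀ (Real.exp_pos _), mul_one]
      exact Real.add_one_le_exp _
    have h2 : ‖z‖ ^ 2 ≤ ‖z‖ ^ 2 / α := by
      rw [le_div_iff₀ hα]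
      nlinarith [sq_nonneg ‖z‖]
    have h3 : ‖z‖ ≤ ‖z‖ ^ 2 / α + 1 := by nlinarith [sq_nonneg (‖z‖ - 1)]
    nlinarith
  -- Multiplying `a = z + u / v` by `v`: a large `|a|` is paid for either by `‖u‖` or by `‖z‖`, and
  -- the latter is absorbed by the exponential.
  have hav : |a| * ‖v‖ ≤ ‖z‖ * ‖v‖ + ‖u‖ := by
    rcases eq_or_ne v 0 with rfl | hv
    · simp
    have : (a : ℂ) * v = z * v + u := by
      rw [hz]
      field_simp
      ring
    calc |a| * ‖v‖ = ‖(a : ℂ) * v‖ := by simp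
      _ ≤ _ := by rw [this]; exact (norm_add_le _ _).trans (by rw [norm_mul])
  have hkey : (1 + |a|) * (‖v‖ * E) ≤ 2 * (‖v‖ + ‖u‖) := by
    have h1 : ‖v‖ * E ≤ ‖v‖ := mul_le_of_le_one_right (norm_nonneg _) hE1
    have h2 : |a| * ‖v‖ * E ≤ (‖z‖ * ‖v‖ + ‖u‖) * E := by gcongr
    have h3 : ‖v‖ * (‖z‖ * E) ≤ ‖v‖ * 1 := by gcongr
    have h4 : ‖u‖ * E ≤ ‖u‖ := mul_le_of_le_one_right (norm_nonneg _) hE1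
    nlinarith [norm_nonneg u]
  calc _ = 1 / (Real.pi * α) * ((1 + |a|) * (‖v‖ * E)) := by ring
    _ ≤ 1 / (Real.pi * α) * (2 * (‖v‖ + ‖u‖)) := by gcongr
    _ = 2 / Real.pi * (α⁻¹ * (‖v‖ + ‖u‖)) := by field_simp
    _ ≤ 1 * (α⁻¹ * (‖v‖ + ‖u‖)) := by
        gcongr
        rw [div_le_one Real.pi_pos]
        exact Real.two_le_pi
    _ = _ := one_mul _

/-- The quotients `u / v` are not Lipschitz, but `v' (z - z') = (u' - u) + (a - z)(v - v')` is
linear in the increments. The only unbounded coefficient is `‖z‖`, and the weighted bound of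
`exp_neg_sq_div_sub_le` controls it because `‖z‖` is the smaller of the two moduli. -/
theorem norm_profile_sub_le_aux {a α : ℝ} (hα : 0 < α) (hα1 : α ≤ 1) {v u v' u' : ℂ}
    (hv : v ≠ 0) (hv' : v' ≠ 0) (hz : ‖(a : ℂ) - u / v‖ ≤ ‖(a : ℂ) - u' / v'‖) :
    ‖profile a α v u - profile a α v' u'‖ ≤
      (α ^ 2)⁻¹ * ((1 + |a|) * (‖v - v'‖ + ‖u - u'‖)) := by
  set z : ℂ := (a : ℂ) - u / v with hzd
  set z' : ℂ := (a : ℂ) - u' / v' with hzd'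
  set E := Real.exp (-(‖z‖ ^ 2 / α)) with hE
  set E' := Real.exp (-(‖z'‖ ^ 2 / α)) with hE'
  have hE1 : E ≤ 1 := Real.exp_le_one_iff.2 (by simp; positivity)
  have hEE : E' ≤ E := by
    rw [hE, hE']
    gcongr
  have hS := exp_neg_sq_div_sub_le hα hα1 (norm_nonneg z) hz
  rw [← hE, ← hE'] at hS
  have hzz : v' * (z - z') = (u' - u) + (a - z) * (v - v') := by
    rw [hzd, hzd']
    field_simp
    ring
  have hzn : ‖v'‖ * (‖z'‖ - ‖z‖) ≤ ‖u - u'‖ + (|a| + ‖z‖) * ‖v - v'‖ := by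
    calc ‖v'‖ * (‖z'‖ - ‖z‖) ≤ ‖v'‖ * ‖z - z'‖ := by
          gcongr
          exact (norm_sub_norm_le z' z).trans_eq (norm_sub_rev _ _)
      _ = ‖(u' - u) + (a - z) * (v - v')‖ := by rw [← norm_mul, hzz]
      _ ≤ ‖u' - u‖ + ‖(a : ℂ) - z‖ * ‖v - v'‖ := by
          rw [← norm_mul]
          exact norm_add_le _ _
      _ ≤ _ := by
          rw [norm_sub_rev u']
          gcongr
          refine (norm_sub_le _ _).trans ?_
          simp
  have hmain : ‖v'‖ * (E - E') ≤ 1 / α * (‖u - u'‖ + |a| * ‖v - v'‖) + 2 * ‖v - v'‖ := by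
    have hq : 0 ≤ ‖z'‖ - ‖z‖ := sub_nonneg.2 hz
    rcases hq.eq_or_lt with h0 | h0
    · have : E = E' := by rw [hE, hE', show ‖z'‖ = ‖z‖ by linarith]
      rw [this, sub_self, mul_zero]
      positivity
    · set D := (E - E') / (‖z'‖ - ‖z‖) with hD
      have hD0 : 0 ≤ D := div_nonneg (sub_nonneg.2 hEE) hq
      have hD1 : D ≤ 1 / α := by rw [hD, div_le_iff₀ h0]; exact hS.1
      have hD2 : ‖z‖ * D ≤ 2 := by
        rw [hD, ← mul_div_assoc, div_le_iff₀ h0]; exact hS.2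
      calc ‖v'‖ * (E - E') = D * (‖v'‖ * (‖z'‖ - ‖z‖)) := by
            rw [hD]; field_simp
        _ ≤ D * (‖u - u'‖ + (|a| + ‖z‖) * ‖v - v'‖) := by gcongr
        _ = D * (‖u - u'‖ + |a| * ‖v - v'‖) + (‖z‖ * D) * ‖v - v'‖ := by ring
        _ ≤ _ := by gcongr
  have hdec : profile a α v u - profile a α v' u' =
      ((1 / (Real.pi * α) : ℝ) : ℂ) * ((v - v') * (E : ℂ) + v' * ((E - E' : ℝ) : ℂ)) := by
    simp only [profile, approxDelta, ← hzd, ← hzd', ← hE, ← hE']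
    push_cast
    ring
  have hnorm : ‖(v - v') * (E : ℂ) + v' * ((E - E' : ℝ) : ℂ)‖ ≤
      ‖v - v'‖ + ‖v'‖ * (E - E') := by
    refine (norm_add_le _ _).trans ?_
    rw [norm_mul, norm_mul, Complex.norm_real, Complex.norm_real,
      Real.norm_of_nonneg (Real.exp_pos _).le, Real.norm_of_nonneg (sub_nonneg.2 hEE)]
    gcongr
    exact mul_le_of_le_one_right (norm_nonneg _) hE1
  have hα' : 1 ≤ 1 / α := by rw [le_div_iff₀ hα]; linarith
  have htot : ‖v - v'‖ + ‖v'‖ * (E - E') ≤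
      3 * (1 / α * ((1 + |a|) * (‖v - v'‖ + ‖u - u'‖))) := by
    have h1 : ‖v - v'‖ ≤ 1 / α * ‖v - v'‖ := le_mul_of_one_le_left (norm_nonneg _) hα'
    have h2 : 0 ≤ 1 / α * (|a| * ‖u - u'‖) := by positivity
    have h3 : 0 ≤ 1 / α * (|a| * ‖v - v'‖) := by positivity
    have h4 : 0 ≤ 1 / α * ‖u - u'‖ := by positivity
    nlinarith
  rw [hdec, norm_mul, Complex.norm_real, Real.norm_of_nonneg (by positivity)]
  calc _ ≤ 1 / (Real.pi * α) * (3 * (1 / α * ((1 + |a|) * (‖v - v'‖ + ‖u - u'‖)))) := by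
        gcongr
        exact hnorm.trans htot
    _ = 3 / Real.pi * ((α ^ 2)⁻¹ * ((1 + |a|) * (‖v - v'‖ + ‖u - u'‖))) := by field_simp
    _ ≤ 1 * ((α ^ 2)⁻¹ * ((1 + |a|) * (‖v - v'‖ + ‖u - u'‖))) := by
        gcongr
        rw [div_le_one Real.pi_pos]
        exact Real.pi_gt_three.le
    _ = _ := one_mul _

/-- The profile is globally Lipschitz, across `v = 0` too. -/
theorem norm_profile_sub_le {a α : ℝ} (hα : 0 < α) (hα1 : α ≤ 1) (v u v' u' : ℂ) :
    ‖profile a α v u - profile a α v' u'‖ ≤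
      (α ^ 2)⁻¹ * ((1 + |a|) * (‖v - v'‖ + ‖u - u'‖)) := by
  have hα' : 1 ≤ 1 / α := by rw [le_div_iff₀ hα]; linarith
  -- If one first argument is `0`, that profile vanishes, and the other is at most `‖v‖ / (πα)`,
  -- where `‖v‖` is now the whole distance between the first arguments.
  have hzero : ∀ v u u' : ℂ, ‖profile a α v u‖ ≤ (α ^ 2)⁻¹ * ((1 + |a|) * (‖v‖ + ‖u - u'‖)) := by
    intro v u u'
    rw [norm_profile hα]
    have hE1 : Real.exp (-(‖(a : ℂ) - u / v‖ ^ 2 / α)) ≤ 1 :=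
      Real.exp_le_one_iff.2 (by simp; positivity)
    have h1 : 1 / (Real.pi * α) ≤ (α ^ 2)⁻¹ := by
      rw [inv_eq_one_div]
      apply one_div_le_one_div_of_le (by positivity)
      nlinarith [Real.pi_gt_three]
    refine mul_le_mul h1 ?_ (by positivity) (by positivity)
    calc _ ≤ ‖v‖ := mul_le_of_le_one_right (norm_nonneg _) hE1
      _ ≤ _ := by nlinarith [norm_nonneg v, norm_nonneg (u - u'), abs_nonneg a,
                mul_nonneg (abs_nonneg a) (norm_nonneg v),
                mul_nonneg (abs_nonneg a) (norm_nonneg (u - u'))]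
  rcases eq_or_ne v 0 with rfl | hv
  · have h0 : profile a α 0 u = 0 := by simp [profile]
    rw [h0, zero_sub, norm_neg, zero_sub, norm_neg, norm_sub_rev u]
    exact hzero _ _ _
  rcases eq_or_ne v' 0 with rfl | hv'
  · have h0 : profile a α 0 u' = 0 := by simp [profile]
    rw [h0, sub_zero, sub_zero]
    exact hzero _ _ _
  rcases le_total ‖(a : ℂ) - u / v‖ ‖(a : ℂ) - u' / v'‖ with h | h
  · exact norm_profile_sub_le_aux hα hα1 hv hv' h
  · rw [norm_sub_rev, norm_sub_rev v, norm_sub_rev u]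
    exact norm_profile_sub_le_aux hα hα1 hv' hv h

/-! ### Covariances of complex random variables -/

section Covariance

variable {Ω : Type*} [MeasurableSpace Ω] {P : Measure Ω}

theorem integrable_mul_conj {X Z : Ω → ℂ} (hX : MemLp X 2 P) (hZ : MemLp Z 2 P) :
    Integrable (fun ω => X ω * conj (Z ω)) P :=
  hX.integrable_mul hZ.star

/-- Cauchy–Schwarz, from the weighted inequality `xz ≤ (q/2p) x² + (p/2q) z²`. -/
theorem norm_integral_mul_conj_le {X Z : Ω → ℂ} (hX : MemLp X 2 P) (hZ : MemLp Z 2 P)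
    {p q : ℝ} (hp : 0 < p) (hq : 0 < q) (hXp : ∫ ω, ‖X ω‖ ^ 2 ∂P ≤ p ^ 2)
    (hZq : ∫ ω, ‖Z ω‖ ^ 2 ∂P ≤ q ^ 2) : ‖∫ ω, X ω * conj (Z ω) ∂P‖ ≤ p * q := by
  have hX2 := hX.integrable_norm_pow (by norm_num)
  have hZ2 := hZ.integrable_norm_pow (by norm_num)
  calc ‖∫ ω, X ω * conj (Z ω) ∂P‖ ≤ ∫ ω, ‖X ω * conj (Z ω)‖ ∂P := norm_integral_le_integral_norm _
    _ ≤ ∫ ω, (q / (2 * p) * ‖X ω‖ ^ 2 + p / (2 * q) * ‖Z ω‖ ^ 2) ∂P := by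
        refine integral_mono (integrable_mul_conj hX hZ).norm
          ((hX2.const_mul _).add (hZ2.const_mul _)) fun ω => ?_
        simp only [norm_mul, RCLike.norm_conj]
        have : q / (2 * p) * ‖X ω‖ ^ 2 + p / (2 * q) * ‖Z ω‖ ^ 2 - ‖X ω‖ * ‖Z ω‖ =
            (q * ‖X ω‖ - p * ‖Z ω‖) ^ 2 / (2 * p * q) := by
          field_simp
          ring
        have h0 : 0 ≤ (q * ‖X ω‖ - p * ‖Z ω‖) ^ 2 / (2 * p * q) := by positivity
        linarith
    _ = q / (2 * p) * ∫ ω, ‖X ω‖ ^ 2 ∂P + p / (2 * q) * ∫ ω, ‖Z ω‖ ^ 2 ∂P := by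
        rw [integral_add (hX2.const_mul _) (hZ2.const_mul _), integral_const_mul,
          integral_const_mul]
    _ ≤ q / (2 * p) * p ^ 2 + p / (2 * q) * q ^ 2 := by gcongr
    _ = p * q := by field_simp; ring

theorem conj_complexCov (X Z : Ω → ℂ) : conj (complexCov X Z P) = complexCov Z X P := by
  unfold complexCov
  rw [← integral_conj]
  congr 1
  funext ω
  rw [map_mul, Complex.conj_conj, mul_comm]

theorem complexVar_eq_complexCov (X : Ω → ℂ) : (complexVar X P : ℂ) = complexCov X X P := by
  unfold complexVar complexCov
  rw [← integral_complex_ofReal]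
  congr 1
  funext ω
  rw [Complex.mul_conj, Complex.normSq_eq_norm_sq]

theorem complexCov_congr {X X' Z Z' : Ω → ℂ} (hX : X =ᵐ[P] X') (hZ : Z =ᵐ[P] Z') :
    complexCov X Z P = complexCov X' Z' P := by
  unfold complexCov
  rw [integral_congr_ae hX, integral_congr_ae hZ]
  refine integral_congr_ae ?_
  filter_upwards [hX, hZ] with ω h1 h2
  rw [h1, h2]

variable [IsProbabilityMeasure P]

theorem complexCov_eq {X Z : Ω → ℂ} (hX : MemLp X 2 P) (hZ : MemLp Z 2 P) :
    complexCov X Z P = ∫ ω, X ω * conj (Z ω) ∂P - (∫ ω, X ω ∂P) * conj (∫ ω, Z ω ∂P) := by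
  have hXi : Integrable X P := hX.integrable (by norm_num)
  have hZi : Integrable (fun ω => conj (Z ω)) P := hZ.star.integrable (by norm_num)
  unfold complexCov
  set m := ∫ ω, X ω ∂P with hm
  set n := ∫ ω, Z ω ∂P with hn
  have h1 : ∀ ω, (X ω - m) * conj (Z ω - n) =
      X ω * conj (Z ω) - X ω * conj n - (m * conj (Z ω) - m * conj n) := fun ω => by
    rw [map_sub]; ring
  have h2 : Integrable (fun ω => X ω * conj (Z ω) - X ω * conj n) P :=
    (integrable_mul_conj hX hZ).sub (hXi.mul_const _)
  have h3 : Integrable (fun ω => m * conj (Z ω) - m * conj n) P :=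
    (hZi.const_mul _).sub (integrable_const _)
  simp_rw [h1]
  rw [integral_sub h2 h3,
    integral_sub (integrable_mul_conj hX hZ) (hXi.mul_const _),
    integral_sub (hZi.const_mul _) (integrable_const _), integral_mul_const,
    integral_const_mul, integral_conj, ← hm, ← hn]
  simp

theorem norm_integral_le_of_sq {X : Ω → ℂ} (hX : MemLp X 2 P) {p : ℝ} (hp : 0 < p)
    (hXp : ∫ ω, ‖X ω‖ ^ 2 ∂P ≤ p ^ 2) : ‖∫ ω, X ω ∂P‖ ≤ p := by
  have := norm_integral_mul_conj_le hX (memLp_const (1 : ℂ)) hp one_pos hXp (by simp)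
  simpa using this

theorem norm_complexCov_le {X Z : Ω → ℂ} (hX : MemLp X 2 P) (hZ : MemLp Z 2 P)
    {p q : ℝ} (hp : 0 < p) (hq : 0 < q) (hXp : ∫ ω, ‖X ω‖ ^ 2 ∂P ≤ p ^ 2)
    (hZq : ∫ ω, ‖Z ω‖ ^ 2 ∂P ≤ q ^ 2) : ‖complexCov X Z P‖ ≤ 2 * (p * q) := by
  rw [complexCov_eq hX hZ]
  refine (norm_sub_le _ _).trans ?_
  rw [norm_mul, RCLike.norm_conj, two_mul]
  exact add_le_add (norm_integral_mul_conj_le hX hZ hp hq hXp hZq)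
    (mul_le_mul (norm_integral_le_of_sq hX hp hXp) (norm_integral_le_of_sq hZ hq hZq)
      (norm_nonneg _) hp.le)

theorem complexCov_sub_left {X X' Z : Ω → ℂ} (hX : MemLp X 2 P) (hX' : MemLp X' 2 P)
    (hZ : MemLp Z 2 P) :
    complexCov (X - X') Z P = complexCov X Z P - complexCov X' Z P := by
  rw [complexCov_eq hX hZ, complexCov_eq hX' hZ, complexCov_eq (hX.sub hX') hZ]
  simp only [Pi.sub_apply, sub_mul]
  rw [integral_sub (integrable_mul_conj hX hZ) (integrable_mul_conj hX' hZ),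
    integral_sub (hX.integrable (by norm_num)) (hX'.integrable (by norm_num))]
  ring

theorem complexCov_eq_zero_of_indepFun {X Z : Ω → ℂ} (hX : MemLp X 2 P) (hZ : MemLp Z 2 P)
    (h : IndepFun X Z P) : complexCov X Z P = 0 := by
  have h' : IndepFun X (fun ω => conj (Z ω)) P :=
    h.comp measurable_id (RCLike.continuous_conj.measurable)
  rw [complexCov_eq hX hZ, h'.integral_fun_mul_eq_mul_integral hX.aestronglyMeasurable
    hZ.star.aestronglyMeasurable, integral_conj, sub_self]

end Covariance

/-! ### Fourier transforms of shifted windows -/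

theorem fourier_apply_eq_integral (κ : 𝓢(ℝ, ℂ)) (x : ℝ) :
    (𝓕 κ : 𝓢(ℝ, ℂ)) x = ∫ s : ℝ, Complex.exp (-2 * Real.pi * Complex.I * x * s) * κ s := by
  rw [SchwartzMap.fourier_coe, Real.fourier_real_eq_integral_exp_smul]
  refine integral_congr_ae (Eventually.of_forall fun s => ?_)
  simp only [smul_eq_mul]
  congr 2
  push_cast
  ring

theorem integral_exp_mul_shift (κ : 𝓢(ℝ, ℂ)) (t η y : ℝ) :
    ∫ s : ℝ, Complex.exp (-2 * Real.pi * Complex.I * y * s) * shift κ t η s =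
      Complex.exp (-2 * Real.pi * Complex.I * y * t) * (𝓕 κ : 𝓢(ℝ, ℂ)) (y + η) := by
  rw [fourier_apply_eq_integral, ← integral_const_mul,
    ← integral_sub_right_eq_self (μ := volume) (fun s : ℝ =>
      Complex.exp (-2 * Real.pi * Complex.I * y * t) * (Complex.exp (-2 * Real.pi * Complex.I * (y + η : ℝ) * s) * κ s)) t]
  refine integral_congr_ae (Eventually.of_forall fun s => ?_)
  simp only [shift_apply]
  rw [← mul_assoc, ← mul_assoc, ← Complex.exp_add, mul_right_comm, ← Complex.exp_add]
  congr 2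
  push_cast
  ring

theorem fourier_shift (κ : 𝓢(ℝ, ℂ)) (t η x : ℝ) :
    (𝓕 (shift κ t η) : 𝓢(ℝ, ℂ)) x =
      Complex.exp (-2 * Real.pi * Complex.I * x * t) * (𝓕 κ : 𝓢(ℝ, ℂ)) (x + η) := by
  rw [fourier_apply_eq_integral, integral_exp_mul_shift]

theorem norm_exp_phase (x t : ℝ) : ‖Complex.exp (-2 * Real.pi * Complex.I * x * t)‖ = 1 := by
  have h : (-2 * Real.pi * Complex.I * x * t : ℂ)
      = ((-2 * Real.pi * x * t : ℝ) : ℂ) * Complex.I := by push_cast; ring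
  rw [h, Complex.norm_exp_ofReal_mul_I]

theorem norm_fourier_shift (κ : 𝓢(ℝ, ℂ)) (t η x : ℝ) :
    ‖(𝓕 (shift κ t η) : 𝓢(ℝ, ℂ)) x‖ = ‖(𝓕 κ : 𝓢(ℝ, ℂ)) (x + η)‖ := by
  rw [fourier_shift, norm_mul, norm_exp_phase, one_mul]

theorem norm_integral_signal_mul_shift {A : ℝ} (hA : 0 ≤ A) (ξ₀ : ℝ) (κ : 𝓢(ℝ, ℂ)) (t η : ℝ) :
    ‖∫ s : ℝ, signal A ξ₀ s * shift κ t η s‖ = A * ‖(𝓕 κ : 𝓢(ℝ, ℂ)) (-ξ₀ + η)‖ := by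
  have h : ∀ s : ℝ, signal A ξ₀ s * shift κ t η s = (A : ℂ) *
      (Complex.exp (-2 * Real.pi * Complex.I * ((-ξ₀ : ℝ) : ℂ) * s) * shift κ t η s) := fun s => by
    rw [signal, mul_assoc]
    congr 3
    push_cast
    ring
  simp_rw [h]
  rw [integral_const_mul, integral_exp_mul_shift, norm_mul, norm_mul, norm_exp_phase, one_mul,
    Complex.norm_real, Real.norm_of_nonneg hA]

theorem fourier_derivCLM (κ : 𝓢(ℝ, ℂ)) (x : ℝ) :
    (𝓕 (SchwartzMap.derivCLM ℂ ℂ κ) : 𝓢(ℝ, ℂ)) x =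
      (2 * Real.pi * Complex.I * x) * (𝓕 κ : 𝓢(ℝ, ℂ)) x := by
  have h : ⇑(SchwartzMap.derivCLM ℂ ℂ κ) = deriv κ := by
    funext s
    exact SchwartzMap.derivCLM_apply ℂ κ s
  rw [SchwartzMap.fourier_coe, h, Real.fourier_deriv κ.integrable κ.differentiable
    (h ▸ (SchwartzMap.derivCLM ℂ ℂ κ).integrable)]
  simp only [smul_eq_mul, SchwartzMap.fourier_coe]

theorem fourier_gaussianWindow (x : ℝ) :
    (𝓕 gaussianWindow : 𝓢(ℝ, ℂ)) x = (Real.exp (-(2 * Real.pi ^ 2 * x ^ 2)) : ℂ) := by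
  have hpi := Real.pi_pos
  have h := congrFun (fourier_gaussian_pi (b := ((1 / (2 * Real.pi) : ℝ) : ℂ))
    (by rw [Complex.ofReal_re]; positivity)) x
  rw [Real.fourier_real_eq_integral_exp_smul] at h
  rw [SchwartzMap.fourier_coe, Real.fourier_real_eq_integral_exp_smul]
  have h1 : ∀ s : ℝ, gaussianWindow s = (((Real.sqrt (2 * Real.pi))⁻¹ : ℝ) : ℂ) *
      Complex.exp (-Real.pi * ((1 / (2 * Real.pi) : ℝ) : ℂ) * s ^ 2) := fun s => by
    rw [gaussianWindow_apply]
    push_cast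
    congr 2
    field_simp
  simp_rw [h1]
  simp only [smul_eq_mul] at h ⊢
  simp_rw [mul_left_comm _ (((Real.sqrt (2 * Real.pi))⁻¹ : ℝ) : ℂ)]
  rw [integral_const_mul, h]
  have h2 : ((1 / (2 * Real.pi) : ℝ) : ℂ) ^ (1 / 2 : ℂ) =
      (((Real.sqrt (2 * Real.pi))⁻¹ : ℝ) : ℂ) := by
    rw [show (1 / 2 : ℂ) = ((1 / 2 : ℝ) : ℂ) by push_cast; rfl,
      ← Complex.ofReal_cpow (by positivity), ← Real.sqrt_eq_rpow, one_div, Real.sqrt_inv]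
  have h3 : (((Real.sqrt (2 * Real.pi))⁻¹ : ℝ) : ℂ) ≠ 0 := by
    rw [Complex.ofReal_ne_zero]
    positivity
  rw [h2, ← mul_assoc, mul_one_div_cancel h3, one_mul]
  push_cast
  congr 1
  field_simp

/-! ### Second moments of the noise -/

section Noise

variable {Ω : Type*} [MeasurableSpace Ω] {P : Measure Ω} [IsProbabilityMeasure P]
  {Φ : 𝓢(ℝ, ℂ) → Ω → ℂ}

theorem IsComplexGaussianWhiteNoise.memLp_two (hΦ : IsComplexGaussianWhiteNoise Φ P)
    (φ : 𝓢(ℝ, ℂ)) : MemLp (Φ φ) 2 P := by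
  have h := (hΦ.gaussian 1 fun _ => φ).map_fun
    (ContinuousLinearMap.proj (R := ℝ) (φ := fun _ : Fin 1 => ℂ) 0)
  exact h.memLp_two

theorem IsComplexGaussianWhiteNoise.integral_norm_sq (hΦ : IsComplexGaussianWhiteNoise Φ P)
    (φ : 𝓢(ℝ, ℂ)) : ∫ ω, ‖Φ φ ω‖ ^ 2 ∂P = ∫ x : ℝ, ‖(𝓕 φ : 𝓢(ℝ, ℂ)) x‖ ^ 2 := by
  have h := hΦ.cov φ φ
  simp_rw [Complex.mul_conj, Complex.normSq_eq_norm_sq] at h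
  rw [integral_complex_ofReal, integral_complex_ofReal] at h
  exact_mod_cast h

theorem memLp_stft (hΦ : IsComplexGaussianWhiteNoise Φ P) (f : ℝ → ℂ) (κ : 𝓢(ℝ, ℂ)) (t η : ℝ) :
    MemLp (stft f Φ κ t η) 2 P :=
  (memLp_const (∫ s : ℝ, f s * shift κ t η s)).add (hΦ.memLp_two (shift κ t η))

/-- A window whose Fourier transform is dominated by `ε e^{-x²/2}` has a transform of size `ε`. -/
theorem integral_norm_stft_sq_le (hΦ : IsComplexGaussianWhiteNoise Φ P) {A : ℝ} (hA : 0 ≤ A)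
    (ξ₀ t η : ℝ) {κ : 𝓢(ℝ, ℂ)} {ε : ℝ} (hε : 0 ≤ ε)
    (hκ : ∀ x, ‖(𝓕 κ : 𝓢(ℝ, ℂ)) x‖ ≤ ε * Real.exp (-(x ^ 2 / 2))) :
    ∫ ω, ‖stft (signal A ξ₀) Φ κ t η ω‖ ^ 2 ∂P ≤
      (2 * (A ^ 2 + Real.sqrt Real.pi)) * ε ^ 2 := by
  set m := ∫ s : ℝ, signal A ξ₀ s * shift κ t η s with hm
  have hΦ2 : Integrable (fun ω => ‖Φ (shift κ t η) ω‖ ^ 2) P :=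
    (hΦ.memLp_two _).integrable_norm_pow (by norm_num)
  have hmle : ‖m‖ ≤ A * ε := by
    rw [hm, norm_integral_signal_mul_shift hA]
    gcongr
    refine (hκ _).trans (mul_le_of_le_one_right hε (Real.exp_le_one_iff.2 ?_))
    have := sq_nonneg (-ξ₀ + η)
    linarith
  have hgauss : ∫ x : ℝ, Real.exp (-1 * x ^ 2) = Real.sqrt Real.pi := by
    simpa using integral_gaussian 1
  have hgi : Integrable (fun x : ℝ => Real.exp (-1 * x ^ 2)) := integrable_exp_neg_mul_sq one_pos
  -- The shift translates the spectrum and multiplies it by a phase, so this bound is uniform in `t`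
  -- and `η`.
  have hnoise : ∫ ω, ‖Φ (shift κ t η) ω‖ ^ 2 ∂P ≤ Real.sqrt Real.pi * ε ^ 2 := by
    rw [hΦ.integral_norm_sq]
    simp_rw [norm_fourier_shift]
    rw [integral_add_right_eq_self (μ := volume) (fun x : ℝ => ‖(𝓕 κ : 𝓢(ℝ, ℂ)) x‖ ^ 2) η,
      ← hgauss, mul_comm, ← integral_const_mul]
    refine integral_mono_of_nonneg (Eventually.of_forall fun x => by positivity)
      (hgi.const_mul _) (Eventually.of_forall fun x => ?_)
    calc ‖(𝓕 κ : 𝓢(ℝ, ℂ)) x‖ ^ 2 ≤ (ε * Real.exp (-(x ^ 2 / 2))) ^ 2 := by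
          gcongr
          exact hκ x
      _ = ε ^ 2 * Real.exp (-1 * x ^ 2) := by
          rw [mul_pow, ← Real.exp_nat_mul]
          congr 2
          push_cast
          ring
  calc ∫ ω, ‖stft (signal A ξ₀) Φ κ t η ω‖ ^ 2 ∂P
      ≤ ∫ ω, (2 * ‖m‖ ^ 2 + 2 * ‖Φ (shift κ t η) ω‖ ^ 2) ∂P := by
        refine integral_mono ((memLp_stft hΦ _ κ t η).integrable_norm_pow (by norm_num))
          ((integrable_const _).add (hΦ2.const_mul _)) fun ω => ?_
        have h1 : ‖stft (signal A ξ₀) Φ κ t η ω‖ ≤ ‖m‖ + ‖Φ (shift κ t η) ω‖ := norm_add_le _ _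
        have h2 : ‖stft (signal A ξ₀) Φ κ t η ω‖ ^ 2 ≤ (‖m‖ + ‖Φ (shift κ t η) ω‖) ^ 2 := by
          gcongr
        simp only
        nlinarith [sq_nonneg (‖m‖ - ‖Φ (shift κ t η) ω‖)]
    _ = 2 * ‖m‖ ^ 2 + 2 * ∫ ω, ‖Φ (shift κ t η) ω‖ ^ 2 ∂P := by
        rw [integral_add (integrable_const _) (hΦ2.const_mul _), integral_const, integral_const_mul]
        simp
    _ ≤ 2 * (A * ε) ^ 2 + 2 * (Real.sqrt Real.pi * ε ^ 2) := by gcongr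
    _ = _ := by ring

/-! ### Independence of spectrally separated families -/

/-- A real-linear functional on `ℂ` has the form `z ↦ a z + b conj z`. A real covariance is
therefore a combination of the covariance, the pseudo-covariance and their conjugates, and the two
hypotheses make the corresponding spectral integrals vanish. -/
theorem IsComplexGaussianWhiteNoise.covariance_comp_eq_zero (hΦ : IsComplexGaussianWhiteNoise Φ P)
    {φ χ : 𝓢(ℝ, ℂ)}
    (h : ∀ x, (𝓕 φ : 𝓢(ℝ, ℂ)) x * (𝓕 χ : 𝓢(ℝ, ℂ)) x = 0)
    (h' : ∀ x, (𝓕 φ : 𝓢(ℝ, ℂ)) x * (𝓕 χ : 𝓢(ℝ, ℂ)) (-x) = 0) (L L' : ℂ →L[ℝ] ℝ) :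
    cov[fun ω => L (Φ φ ω), fun ω => L' (Φ χ ω); P] = 0 := by
  have hL : ∀ (L : ℂ →L[ℝ] ℝ) (z : ℂ), (L z : ℂ) =
      ((L 1 - L Complex.I * Complex.I) / 2) * z + ((L 1 + L Complex.I * Complex.I) / 2) * conj z := by
    intro L z
    have hz : L z = z.re * L 1 + z.im * L Complex.I := by
      conv_lhs => rw [← Complex.re_add_im z]
      have : (z.re : ℂ) + z.im * Complex.I = z.re • (1 : ℂ) + z.im • Complex.I := by simp
      rw [this, map_add, map_smul, map_smul, smul_eq_mul, smul_eq_mul]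
    rw [hz]
    conv_rhs => rw [← Complex.re_add_im z]
    simp only [map_add, map_mul, Complex.conj_ofReal, Complex.conj_I]
    push_cast
    linear_combination ((L Complex.I) * z.im : ℂ) * Complex.I_sq
  have hφ := hΦ.memLp_two φ
  have hχ := hΦ.memLp_two χ
  have hcov : ∫ ω, Φ φ ω * conj (Φ χ ω) ∂P = 0 := by
    rw [hΦ.cov]
    refine integral_eq_zero_of_ae (Eventually.of_forall fun x => ?_)
    rcases mul_eq_zero.1 (h x) with h0 | h0 <;> simp [h0]
  have hpcov : ∫ ω, Φ φ ω * Φ χ ω ∂P = 0 := by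
    rw [hΦ.pseudocov]
    exact integral_eq_zero_of_ae (Eventually.of_forall h')
  have hmean : ∀ (L : ℂ →L[ℝ] ℝ) (φ : 𝓢(ℝ, ℂ)), ∫ ω, L (Φ φ ω) ∂P = 0 := fun L φ => by
    rw [L.integral_comp_comm ((hΦ.memLp_two φ).integrable (by norm_num)), hΦ.mean_zero, map_zero]
  rw [covariance, hmean, hmean]
  simp only [sub_zero]
  rw [← Complex.ofReal_eq_zero, ← integral_complex_ofReal]
  set a := (L 1 - L Complex.I * Complex.I : ℂ) / 2
  set b := (L 1 + L Complex.I * Complex.I : ℂ) / 2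
  set a' := (L' 1 - L' Complex.I * Complex.I : ℂ) / 2
  set b' := (L' 1 + L' Complex.I * Complex.I : ℂ) / 2
  have hexp : ∀ ω, ((L (Φ φ ω) * L' (Φ χ ω) : ℝ) : ℂ) =
      (a * a') * (Φ φ ω * Φ χ ω) + (a * b') * (Φ φ ω * conj (Φ χ ω)) +
        ((b * a') * conj (Φ φ ω * conj (Φ χ ω)) + (b * b') * conj (Φ φ ω * Φ χ ω)) := fun ω => by
    rw [Complex.ofReal_mul, hL L, hL L']
    simp only [map_mul, Complex.conj_conj]
    ring
  have i1 : Integrable (fun ω => Φ φ ω * Φ χ ω) P := hφ.integrable_mul hχ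
  have i2 : Integrable (fun ω => Φ φ ω * conj (Φ χ ω)) P := integrable_mul_conj hφ hχ
  have i3 : Integrable (fun ω => conj (Φ φ ω * conj (Φ χ ω))) P :=
    (Complex.conjLIE.integrable_comp_iff).2 i2
  have i4 : Integrable (fun ω => conj (Φ φ ω * Φ χ ω)) P :=
    (Complex.conjLIE.integrable_comp_iff).2 i1
  simp_rw [hexp]
  have j1 : Integrable (fun ω => (a * a') * (Φ φ ω * Φ χ ω) +
      (a * b') * (Φ φ ω * conj (Φ χ ω))) P := (i1.const_mul _).add (i2.const_mul _)
  have j2 : Integrable (fun ω => (b * a') * conj (Φ φ ω * conj (Φ χ ω)) +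
      (b * b') * conj (Φ φ ω * Φ χ ω)) P := (i3.const_mul _).add (i4.const_mul _)
  rw [integral_add j1 j2,
    integral_add (i1.const_mul _) (i2.const_mul _), integral_add (i3.const_mul _) (i4.const_mul _)]
  simp only [integral_const_mul, integral_conj, hcov, hpcov]
  simp

theorem IsComplexGaussianWhiteNoise.indepFun_pair (hΦ : IsComplexGaussianWhiteNoise Φ P)
    {φ χ : Fin 2 → 𝓢(ℝ, ℂ)}
    (h : ∀ i j x, (𝓕 (φ i) : 𝓢(ℝ, ℂ)) x * (𝓕 (χ j) : 𝓢(ℝ, ℂ)) x = 0)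
    (h' : ∀ i j x, (𝓕 (φ i) : 𝓢(ℝ, ℂ)) x * (𝓕 (χ j) : 𝓢(ℝ, ℂ)) (-x) = 0) :
    IndepFun (fun ω => (Φ (φ 0) ω, Φ (φ 1) ω)) (fun ω => (Φ (χ 0) ω, Φ (χ 1) ω)) P := by
  have hG := (hΦ.gaussian 4 ![φ 0, φ 1, χ 0, χ 1]).map_fun
    (((ContinuousLinearMap.proj (R := ℝ) (φ := fun _ : Fin 4 => ℂ) 0).prod
      (ContinuousLinearMap.proj (R := ℝ) (φ := fun _ : Fin 4 => ℂ) 1)).prod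
      ((ContinuousLinearMap.proj (R := ℝ) (φ := fun _ : Fin 4 => ℂ) 2).prod
      (ContinuousLinearMap.proj (R := ℝ) (φ := fun _ : Fin 4 => ℂ) 3)))
  refine HasGaussianLaw.indepFun_of_covariance_strongDual (X := fun ω => (Φ (φ 0) ω, Φ (φ 1) ω))
    (Y := fun ω => (Φ (χ 0) ω, Φ (χ 1) ω)) hG fun L L' => ?_
  have hsplit : ∀ (L : StrongDual ℝ (ℂ × ℂ)) (φ : Fin 2 → 𝓢(ℝ, ℂ)),
      (L ∘ fun ω => (Φ (φ 0) ω, Φ (φ 1) ω)) =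
        (fun ω => (L ∘L ContinuousLinearMap.inl ℝ ℂ ℂ) (Φ (φ 0) ω)) +
          fun ω => (L ∘L ContinuousLinearMap.inr ℝ ℂ ℂ) (Φ (φ 1) ω) := by
    intro L φ
    funext ω
    simp [← map_add]
  have hm : ∀ (L : ℂ →L[ℝ] ℝ) (φ : 𝓢(ℝ, ℂ)), MemLp (fun ω => L (Φ φ ω)) 2 P :=
    fun L φ => L.comp_memLp' (hΦ.memLp_two φ)
  rw [hsplit, hsplit, covariance_add_left (hm _ _) (hm _ _) ((hm _ _).add (hm _ _)),
    covariance_add_right (hm _ _) (hm _ _) (hm _ _),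
    covariance_add_right (hm _ _) (hm _ _) (hm _ _)]
  simp only [hΦ.covariance_comp_eq_zero (h _ _) (h' _ _), add_zero]

end Noise

/-! ### Linearity of the short-time Fourier transform -/

section Linearity

variable {Ω : Type*} [MeasurableSpace Ω] {P : Measure Ω} [IsProbabilityMeasure P]
  {Φ : 𝓢(ℝ, ℂ) → Ω → ℂ}

theorem integrable_signal_mul (A ξ₀ : ℝ) (φ : 𝓢(ℝ, ℂ)) :
    Integrable fun s : ℝ => signal A ξ₀ s * φ s := by
  refine φ.integrable.bdd_mul (c := |A|) ?_ (Eventually.of_forall fun s => ?_)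
  · unfold signal
    exact (by fun_prop : Continuous _).aestronglyMeasurable
  · have h : (2 * Real.pi * Complex.I * ξ₀ * s : ℂ)
        = ((2 * Real.pi * ξ₀ * s : ℝ) : ℂ) * Complex.I := by push_cast; ring
    rw [signal, norm_mul, h, Complex.norm_exp_ofReal_mul_I, mul_one, Complex.norm_real,
      Real.norm_eq_abs]

theorem observe_smul_add_smul (hΦ : IsComplexGaussianWhiteNoise Φ P) (A ξ₀ : ℝ) (a b : ℂ)
    (φ χ : 𝓢(ℝ, ℂ)) :
    observe (signal A ξ₀) Φ (a • φ + b • χ) =ᵐ[P] fun ω =>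
      a * observe (signal A ξ₀) Φ φ ω + b * observe (signal A ξ₀) Φ χ ω := by
  have hint : ∫ s : ℝ, signal A ξ₀ s * (a • φ + b • χ) s =
      a * (∫ s : ℝ, signal A ξ₀ s * φ s) + b * ∫ s : ℝ, signal A ξ₀ s * χ s := by
    rw [← integral_const_mul, ← integral_const_mul,
      ← integral_add ((integrable_signal_mul A ξ₀ φ).const_mul a)
        ((integrable_signal_mul A ξ₀ χ).const_mul b)]
    refine integral_congr_ae (Eventually.of_forall fun s => ?_)
    simp only [_root_.add_apply, _root_.smul_apply, smul_eq_mul]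
    ring
  filter_upwards [hΦ.map_add (a • φ) (b • χ), hΦ.map_smul a φ, hΦ.map_smul b χ] with ω h1 h2 h3
  simp only [Pi.add_apply, Pi.smul_apply, smul_eq_mul] at h1 h2 h3
  rw [observe, hint, h1, h2, h3, observe, observe]
  ring

theorem shift_sub (κ κ' : 𝓢(ℝ, ℂ)) (t η : ℝ) :
    shift (κ - κ') t η = shift κ t η - shift κ' t η := by
  simp only [shift, map_sub]

theorem stft_sub (hΦ : IsComplexGaussianWhiteNoise Φ P) (A ξ₀ : ℝ) (κ κ' : 𝓢(ℝ, ℂ)) (t η : ℝ) :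
    stft (signal A ξ₀) Φ (κ - κ') t η =ᵐ[P] fun ω =>
      stft (signal A ξ₀) Φ κ t η ω - stft (signal A ξ₀) Φ κ' t η ω := by
  have h := observe_smul_add_smul hΦ A ξ₀ 1 (-1) (shift κ t η) (shift κ' t η)
  have hs : shift (κ - κ') t η = (1 : ℂ) • shift κ t η + (-1 : ℂ) • shift κ' t η := by
    rw [shift_sub, one_smul, neg_one_smul, sub_eq_add_neg]
  filter_upwards [h] with ω hω
  rw [stft, hs, hω, stft, stft]
  ring

theorem stftDeriv_ae_eq (hΦ : IsComplexGaussianWhiteNoise Φ P) (A ξ₀ : ℝ) (κ : 𝓢(ℝ, ℂ))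
    (t η : ℝ) :
    stftDeriv (signal A ξ₀) Φ κ t η =ᵐ[P] fun ω =>
      -stft (signal A ξ₀) Φ (SchwartzMap.derivCLM ℂ ℂ κ) t η ω +
        2 * Real.pi * Complex.I * η * stft (signal A ξ₀) Φ κ t η ω := by
  have h := observe_smul_add_smul hΦ A ξ₀ (-1) (2 * Real.pi * Complex.I * η)
    (shift (SchwartzMap.derivCLM ℂ ℂ κ) t η) (shift κ t η)
  filter_upwards [h] with ω hω
  rw [stftDeriv, shiftDeriv, ← neg_one_smul ℂ, hω, stft, stft]
  ring

end Linearity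

/-! ### The integrand as a profile of two short-time Fourier transforms -/

section Profile

variable {Ω : Type*} [MeasurableSpace Ω] {P : Measure Ω} [IsProbabilityMeasure P]
  {Φ : 𝓢(ℝ, ℂ) → Ω → ℂ}

/-- The short-time Fourier transform with respect to the window `-(2πi)⁻¹ κ'`, which equals
`(2πi)⁻¹ ∂_t V - η V` almost surely. -/
noncomputable def derivStft (f : ℝ → ℂ) (Φ : 𝓢(ℝ, ℂ) → Ω → ℂ) (κ : 𝓢(ℝ, ℂ)) (t η : ℝ) (ω : Ω) :
    ℂ :=
  -(1 / (2 * Real.pi * Complex.I)) * stft f Φ (SchwartzMap.derivCLM ℂ ℂ κ) t η ω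

/-- A version of the SST integrand that depends on `η` only through `ξ - η` and two short-time
Fourier transforms of bounded variance. -/
noncomputable def sstVersion (f : ℝ → ℂ) (Φ : 𝓢(ℝ, ℂ) → Ω → ℂ) (κ : 𝓢(ℝ, ℂ)) (α ξ t η : ℝ)
    (ω : Ω) : ℂ :=
  profile (ξ - η) α (stft f Φ κ t η ω) (derivStft f Φ κ t η ω)

/-- The equality is only almost sure because `Φ` is linear only almost surely. Where `V = 0`, the
prefactor kills both sides. -/
theorem sstIntegrand_ae_eq (hΦ : IsComplexGaussianWhiteNoise Φ P) (A ξ₀ : ℝ) (κ : 𝓢(ℝ, ℂ))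
    (α ξ t η : ℝ) :
    sstIntegrand (signal A ξ₀) Φ κ α ξ t η =ᵐ[P] sstVersion (signal A ξ₀) Φ κ α ξ t η := by
  filter_upwards [stftDeriv_ae_eq hΦ A ξ₀ κ t η] with ω hω
  rw [sstIntegrand, sstVersion, profile]
  rcases eq_or_ne (stft (signal A ξ₀) Φ κ t η ω) 0 with h0 | h0
  · rw [h0, zero_mul, zero_mul]
  · congr 3
    rw [reassignment, hω, derivStft]
    have hpi : (Real.pi : ℂ) ≠ 0 := Complex.ofReal_ne_zero.2 Real.pi_ne_zero
    have hI := Complex.I_ne_zero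
    push_cast
    field_simp
    ring

theorem memLp_derivStft (hΦ : IsComplexGaussianWhiteNoise Φ P) (f : ℝ → ℂ) (κ : 𝓢(ℝ, ℂ))
    (t η : ℝ) : MemLp (derivStft f Φ κ t η) 2 P :=
  (memLp_stft hΦ f _ t η).const_mul _

theorem norm_derivStft {Ω : Type*} {Φ : 𝓢(ℝ, ℂ) → Ω → ℂ} (f : ℝ → ℂ) (κ : 𝓢(ℝ, ℂ))
    (t η : ℝ) (ω : Ω) :
    ‖derivStft f Φ κ t η ω‖ =
      (2 * Real.pi)⁻¹ * ‖stft f Φ (SchwartzMap.derivCLM ℂ ℂ κ) t η ω‖ := by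
  rw [derivStft, norm_mul, norm_neg]
  simp [abs_of_pos Real.pi_pos]

theorem derivStft_sub (hΦ : IsComplexGaussianWhiteNoise Φ P) (A ξ₀ : ℝ) (κ κ' : 𝓢(ℝ, ℂ))
    (t η : ℝ) :
    derivStft (signal A ξ₀) Φ (κ - κ') t η =ᵐ[P] fun ω =>
      derivStft (signal A ξ₀) Φ κ t η ω - derivStft (signal A ξ₀) Φ κ' t η ω := by
  filter_upwards [stft_sub hΦ A ξ₀ (SchwartzMap.derivCLM ℂ ℂ κ) (SchwartzMap.derivCLM ℂ ℂ κ') t η]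
    with ω hω
  rw [derivStft, map_sub, hω, derivStft, derivStft]
  ring

theorem memLp_sstVersion (hΦ : IsComplexGaussianWhiteNoise Φ P) (f : ℝ → ℂ) (κ : 𝓢(ℝ, ℂ))
    {α : ℝ} (hα : 0 < α) (hα1 : α ≤ 1) (ξ t η : ℝ) : MemLp (sstVersion f Φ κ α ξ t η) 2 P := by
  have hV := memLp_stft hΦ f κ t η
  have hU := memLp_derivStft hΦ f κ t η
  refine MemLp.of_le_mul (c := α⁻¹) (hV.norm.add hU.norm) ?_ (Eventually.of_forall fun ω => ?_)
  · exact ((measurable_profile (ξ - η) α).comp_aemeasurable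
      (hV.aestronglyMeasurable.aemeasurable.prodMk
        hU.aestronglyMeasurable.aemeasurable)).aestronglyMeasurable
  · rw [Pi.add_apply, Real.norm_of_nonneg (by positivity)]
    refine le_trans ?_ (norm_profile_le (a := ξ - η) hα hα1 _ _)
    exact le_mul_of_one_le_left (norm_nonneg _) (by linarith [abs_nonneg (ξ - η)])

/-- The constant in the second moment bounds below. -/
noncomputable def momentConst (A : ℝ) : ℝ := Real.sqrt (8 * (A ^ 2 + Real.sqrt Real.pi))

theorem momentConst_pos (A : ℝ) : 0 < momentConst A := by
  have := Real.sqrt_pos.2 Real.pi_pos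
  exact Real.sqrt_pos.2 (by positivity)

/-- Differentiating the window multiplies its transform by `2πix`. Weakening `e^{-x²}` to
`e^{-x²/2}` absorbs `|x|`, and the `2π` cancels against `derivStft`. -/
theorem integral_stft_add_derivStft_sq_le (hΦ : IsComplexGaussianWhiteNoise Φ P) {A : ℝ}
    (hA : 0 ≤ A) (ξ₀ t η : ℝ) {κ : 𝓢(ℝ, ℂ)} {ε : ℝ} (hε : 0 ≤ ε)
    (hκ : ∀ x, ‖(𝓕 κ : 𝓢(ℝ, ℂ)) x‖ ≤ ε * Real.exp (-x ^ 2)) :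
    ∫ ω, (‖stft (signal A ξ₀) Φ κ t η ω‖ + ‖derivStft (signal A ξ₀) Φ κ t η ω‖) ^ 2 ∂P ≤
      (momentConst A * ε) ^ 2 := by
  have hpi := Real.pi_pos
  have hV := integral_norm_stft_sq_le hΦ hA ξ₀ t η hε fun x => (hκ x).trans (by
    gcongr
    nlinarith [sq_nonneg x])
  have hU' := integral_norm_stft_sq_le hΦ hA ξ₀ t η (κ := SchwartzMap.derivCLM ℂ ℂ κ)
    (ε := 2 * Real.pi * ε) (by positivity) fun x => by
      have hx : |x| * Real.exp (-x ^ 2) ≤ Real.exp (-(x ^ 2 / 2)) := by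
        have h1 : |x| ≤ Real.exp (x ^ 2 / 2) := by
          refine le_trans ?_ (Real.add_one_le_exp _)
          nlinarith [sq_nonneg (|x| - 1), sq_abs x]
        calc |x| * Real.exp (-x ^ 2) ≤ Real.exp (x ^ 2 / 2) * Real.exp (-x ^ 2) := by gcongr
          _ = _ := by rw [← Real.exp_add]; congr 1; ring
      rw [fourier_derivCLM, norm_mul]
      have hn : ‖(2 * Real.pi * Complex.I * x : ℂ)‖ = 2 * Real.pi * |x| := by
        simp [abs_of_pos hpi]
      rw [hn]
      calc 2 * Real.pi * |x| * ‖(𝓕 κ : 𝓢(ℝ, ℂ)) x‖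
          ≤ 2 * Real.pi * |x| * (ε * Real.exp (-x ^ 2)) := by
            gcongr
            exact hκ x
        _ = 2 * Real.pi * ε * (|x| * Real.exp (-x ^ 2)) := by ring
        _ ≤ _ := by gcongr
  have hU : ∫ ω, ‖derivStft (signal A ξ₀) Φ κ t η ω‖ ^ 2 ∂P ≤
      2 * (A ^ 2 + Real.sqrt Real.pi) * ε ^ 2 := by
    simp_rw [norm_derivStft, mul_pow]
    rw [integral_const_mul]
    calc _ ≤ ((2 * Real.pi)⁻¹) ^ 2 *
          (2 * (A ^ 2 + Real.sqrt Real.pi) * (2 * Real.pi * ε) ^ 2) := by gcongr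
      _ = _ := by field_simp
  have hV2 := (memLp_stft hΦ (signal A ξ₀) κ t η).integrable_norm_pow (p := 2) (by norm_num)
  have hU2 := (memLp_derivStft hΦ (signal A ξ₀) κ t η).integrable_norm_pow (p := 2) (by norm_num)
  calc _ ≤ ∫ ω, (2 * ‖stft (signal A ξ₀) Φ κ t η ω‖ ^ 2 +
          2 * ‖derivStft (signal A ξ₀) Φ κ t η ω‖ ^ 2) ∂P := by
        refine integral_mono_of_nonneg (Eventually.of_forall fun ω => by positivity)
          ((hV2.const_mul _).add (hU2.const_mul _)) (Eventually.of_forall fun ω => ?_)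
        simp only
        nlinarith [sq_nonneg (‖stft (signal A ξ₀) Φ κ t η ω‖ -
          ‖derivStft (signal A ξ₀) Φ κ t η ω‖)]
    _ = 2 * ∫ ω, ‖stft (signal A ξ₀) Φ κ t η ω‖ ^ 2 ∂P +
          2 * ∫ ω, ‖derivStft (signal A ξ₀) Φ κ t η ω‖ ^ 2 ∂P := by
        rw [integral_add (hV2.const_mul _) (hU2.const_mul _), integral_const_mul,
          integral_const_mul]
    _ ≤ 2 * (2 * (A ^ 2 + Real.sqrt Real.pi) * ε ^ 2) +
          2 * (2 * (A ^ 2 + Real.sqrt Real.pi) * ε ^ 2) := by gcongr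
    _ = _ := by
        rw [mul_pow, momentConst, Real.sq_sqrt (by positivity)]
        ring

theorem integral_norm_sstVersion_sq_le (hΦ : IsComplexGaussianWhiteNoise Φ P) {A : ℝ}
    (hA : 0 ≤ A) (ξ₀ ξ t η : ℝ) {α : ℝ} (hα : 0 < α) (hα1 : α ≤ 1) {κ : 𝓢(ℝ, ℂ)}
    (hκ : ∀ x, ‖(𝓕 κ : 𝓢(ℝ, ℂ)) x‖ ≤ Real.exp (-x ^ 2)) :
    ∫ ω, ‖sstVersion (signal A ξ₀) Φ κ α ξ t η ω‖ ^ 2 ∂P ≤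
      (α⁻¹ / (1 + |ξ - η|) * momentConst A) ^ 2 := by
  have h := integral_stft_add_derivStft_sq_le hΦ hA ξ₀ t η zero_le_one (by simpa using hκ)
  have hi := ((memLp_stft hΦ (signal A ξ₀) κ t η).norm.add
    (memLp_derivStft hΦ (signal A ξ₀) κ t η).norm).integrable_sq
  have ha : 0 < 1 + |ξ - η| := by positivity
  calc _ ≤ ∫ ω, (α⁻¹ / (1 + |ξ - η|)) ^ 2 * (‖stft (signal A ξ₀) Φ κ t η ω‖ +
        ‖derivStft (signal A ξ₀) Φ κ t η ω‖) ^ 2 ∂P := by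
        refine integral_mono_of_nonneg (Eventually.of_forall fun ω => by positivity)
          (hi.const_mul _) (Eventually.of_forall fun ω => ?_)
        simp only
        rw [← mul_pow]
        gcongr
        rw [div_mul_eq_mul_div, le_div_iff₀ ha, mul_comm]
        exact norm_profile_le hα hα1 _ _
    _ ≤ _ := by
        rw [integral_const_mul, mul_pow (α⁻¹ / (1 + |ξ - η|))]
        gcongr
        simpa using h

theorem integral_norm_sstVersion_sub_sq_le (hΦ : IsComplexGaussianWhiteNoise Φ P) {A : ℝ}
    (hA : 0 ≤ A) (ξ₀ ξ t η : ℝ) {α : ℝ} (hα : 0 < α) (hα1 : α ≤ 1) {κ κ' : 𝓢(ℝ, ℂ)} {ε : ℝ}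
    (hε : 0 ≤ ε) (hκ : ∀ x, ‖(𝓕 (κ - κ') : 𝓢(ℝ, ℂ)) x‖ ≤ ε * Real.exp (-x ^ 2)) :
    ∫ ω, ‖(sstVersion (signal A ξ₀) Φ κ α ξ t η - sstVersion (signal A ξ₀) Φ κ' α ξ t η) ω‖ ^ 2 ∂P
      ≤ ((α ^ 2)⁻¹ * (1 + |ξ - η|) * (momentConst A * ε)) ^ 2 := by
  have h := integral_stft_add_derivStft_sq_le hΦ hA ξ₀ t η hε hκ
  have hi := ((memLp_stft hΦ (signal A ξ₀) (κ - κ') t η).norm.add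
    (memLp_derivStft hΦ (signal A ξ₀) (κ - κ') t η).norm).integrable_sq
  calc _ ≤ ∫ ω, ((α ^ 2)⁻¹ * (1 + |ξ - η|)) ^ 2 *
        (‖stft (signal A ξ₀) Φ (κ - κ') t η ω‖ +
          ‖derivStft (signal A ξ₀) Φ (κ - κ') t η ω‖) ^ 2 ∂P := by
        refine integral_mono_of_nonneg (Eventually.of_forall fun ω => by positivity)
          (hi.const_mul _) ?_
        filter_upwards [stft_sub hΦ A ξ₀ κ κ' t η, derivStft_sub hΦ A ξ₀ κ κ' t η] with ω h1 h2
        rw [h1, h2, ← mul_pow, mul_assoc]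
        gcongr
        exact norm_profile_sub_le hα hα1 _ _ _ _
    _ ≤ _ := by
        rw [integral_const_mul, mul_pow ((α ^ 2)⁻¹ * (1 + |ξ - η|))]
        gcongr

/-- Perturbing the window changes covariances by an amount that grows at most linearly in
`|η - η'|`. -/
theorem norm_complexCov_sstVersion_sub_le (hΦ : IsComplexGaussianWhiteNoise Φ P) {A : ℝ}
    (hA : 0 ≤ A) (ξ₀ ξ t η η' : ℝ) {α : ℝ} (hα : 0 < α) (hα1 : α ≤ 1) {κ κ' χ : 𝓢(ℝ, ℂ)} {ε : ℝ}
    (hε : 0 < ε) (hκ : ∀ x, ‖(𝓕 (κ - κ') : 𝓢(ℝ, ℂ)) x‖ ≤ ε * Real.exp (-x ^ 2))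
    (hχ : ∀ x, ‖(𝓕 χ : 𝓢(ℝ, ℂ)) x‖ ≤ Real.exp (-x ^ 2)) :
    ‖complexCov (sstVersion (signal A ξ₀) Φ κ α ξ t η - sstVersion (signal A ξ₀) Φ κ' α ξ t η)
        (sstVersion (signal A ξ₀) Φ χ α ξ t η') P‖ ≤
      2 * momentConst A ^ 2 * (α ^ 3)⁻¹ * ((1 + |η - η'|) * ε) := by
  have hc := momentConst_pos A
  have ha : 0 < 1 + |ξ - η'| := by positivity
  refine (norm_complexCov_le
    ((memLp_sstVersion hΦ _ κ hα hα1 ξ t η).sub (memLp_sstVersion hΦ _ κ' hα hα1 ξ t η))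
    (memLp_sstVersion hΦ _ χ hα hα1 ξ t η') (by positivity) (by positivity)
    (integral_norm_sstVersion_sub_sq_le hΦ hA ξ₀ ξ t η hα hα1 hε.le hκ)
    (integral_norm_sstVersion_sq_le hΦ hA ξ₀ ξ t η' hα hα1 hχ)).trans ?_
  -- The growing Lipschitz constant at `η` meets the decay of the profile at `η'`, so only the
  -- distance `|η - η'|` survives.
  have hratio : (1 + |ξ - η|) / (1 + |ξ - η'|) ≤ 1 + |η - η'| := by
    rw [div_le_iff₀ ha]
    have h1 : |ξ - η| ≤ |ξ - η'| + |η - η'| := by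
      rw [abs_sub_comm η η']
      exact abs_sub_le ξ η' η
    nlinarith [mul_nonneg (abs_nonneg (η - η')) (abs_nonneg (ξ - η'))]
  calc _ = 2 * momentConst A ^ 2 * (α ^ 3)⁻¹ *
        ((1 + |ξ - η|) / (1 + |ξ - η'|) * ε) := by field_simp
    _ ≤ _ := by gcongr

/-! ### Decorrelation of windows with separated frequencies -/

theorem fourier_truncatedWindow_of_hasTemperateGrowth {ψ : ℝ → ℝ}
    (hψ : (fun x : ℝ => (ψ x : ℂ)).HasTemperateGrowth) (κ : 𝓢(ℝ, ℂ)) (x : ℝ) :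
    (𝓕 (truncatedWindow ψ κ) : 𝓢(ℝ, ℂ)) x = ψ x * (𝓕 κ : 𝓢(ℝ, ℂ)) x := by
  rw [truncatedWindow, FourierTransform.fourier_fourierInv_eq,
    SchwartzMap.smulLeftCLM_apply_apply hψ, smul_eq_mul]

/-- Cutting off the frequencies beyond `r` costs `e^{-18 r²}`. -/
theorem norm_fourier_sub_truncatedWindow_le {ψ : ℝ → ℝ} {κ : 𝓢(ℝ, ℂ)} {r : ℝ} (hr : 0 ≤ r)
    (hψ : (fun x : ℝ => (ψ x : ℂ)).HasTemperateGrowth)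
    (h0 : ∀ x, 0 ≤ ψ x) (h1 : ∀ x, ψ x ≤ 1) (hr1 : ∀ x, |x| ≤ r → ψ x = 1)
    (hκ : ∀ x, ‖(𝓕 κ : 𝓢(ℝ, ℂ)) x‖ ≤ Real.exp (-(19 * x ^ 2))) (x : ℝ) :
    ‖(𝓕 (κ - truncatedWindow ψ κ) : 𝓢(ℝ, ℂ)) x‖ ≤
      Real.exp (-(18 * r ^ 2)) * Real.exp (-x ^ 2) := by
  have hsub : (𝓕 (κ - truncatedWindow ψ κ) : 𝓢(ℝ, ℂ)) x =
      ((1 - ψ x : ℝ) : ℂ) * (𝓕 κ : 𝓢(ℝ, ℂ)) x := by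
    rw [sub_eq_add_neg, FourierTransform.fourier_add, FourierTransform.fourier_neg,
      ← sub_eq_add_neg, _root_.sub_apply,
      fourier_truncatedWindow_of_hasTemperateGrowth hψ]
    push_cast
    ring
  rw [hsub, norm_mul, Complex.norm_real, Real.norm_of_nonneg (sub_nonneg.2 (h1 x))]
  rcases le_or_gt |x| r with hx | hx
  · rw [hr1 x hx, sub_self, zero_mul]
    positivity
  -- Of the exponent `19x²`, the part `18x²` gives smallness beyond `r`, and one `x²` is kept for
  -- integrability.
  · calc (1 - ψ x) * ‖(𝓕 κ : 𝓢(ℝ, ℂ)) x‖ ≤ 1 * Real.exp (-(19 * x ^ 2)) := by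
          gcongr
          · linarith [h0 x]
          · exact hκ x
      _ ≤ _ := by
          rw [one_mul, ← Real.exp_add]
          gcongr
          have : r ^ 2 ≤ x ^ 2 := by
            rw [← sq_abs x]
            gcongr
          linarith

theorem norm_fourier_truncatedWindow_le {ψ : ℝ → ℝ} {κ : 𝓢(ℝ, ℂ)}
    (hψ : (fun x : ℝ => (ψ x : ℂ)).HasTemperateGrowth)
    (h0 : ∀ x, 0 ≤ ψ x) (h1 : ∀ x, ψ x ≤ 1) (x : ℝ) :
    ‖(𝓕 (truncatedWindow ψ κ) : 𝓢(ℝ, ℂ)) x‖ ≤ ‖(𝓕 κ : 𝓢(ℝ, ℂ)) x‖ := by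
  rw [fourier_truncatedWindow_of_hasTemperateGrowth hψ, norm_mul, Complex.norm_real,
    Real.norm_of_nonneg (h0 x)]
  exact mul_le_of_le_one_left (norm_nonneg _) (h1 x)

theorem contDiffBump_hasTemperateGrowth {c : ℝ} (b : ContDiffBump c) :
    (fun x : ℝ => (b x : ℂ)).HasTemperateGrowth := by
  have hc : HasCompactSupport (fun x : ℝ => (b x : ℂ)) :=
    b.hasCompactSupport.comp_left (g := ((↑) : ℝ → ℂ)) Complex.ofReal_zero
  have hs : ContDiff ℝ (⊤ : ℕ∞) (fun x : ℝ => (b x : ℂ)) :=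
    Complex.ofRealCLM.contDiff.comp b.contDiff
  exact (hc.toSchwartzMap hs).hasTemperateGrowth

/-- The shifted spectra lie within `r` of `-η` and `-η'`, hence are disjoint. The pseudo-covariance
compares one with the reflection of the other, at distance `η + η'`; positivity of both frequencies
gives `|η - η'| ≤ η + η'`. -/
theorem indepFun_sstVersion (hΦ : IsComplexGaussianWhiteNoise Φ P) (f : ℝ → ℂ)
    {κ χ : 𝓢(ℝ, ℂ)} {r η η' : ℝ} (α ξ t : ℝ) (hη : 0 < η) (hη' : 0 < η')
    (hr : 2 * r ≤ |η - η'|)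
    (hκ : ∀ x, r ≤ |x| → (𝓕 κ : 𝓢(ℝ, ℂ)) x = 0) (hχ : ∀ x, r ≤ |x| → (𝓕 χ : 𝓢(ℝ, ℂ)) x = 0) :
    IndepFun (sstVersion f Φ κ α ξ t η) (sstVersion f Φ χ α ξ t η') P := by
  have hprod : ∀ x y : ℝ, |η - η'| ≤ |x| + |y| →
      (𝓕 κ : 𝓢(ℝ, ℂ)) x * (𝓕 χ : 𝓢(ℝ, ℂ)) y = 0 := by
    intro x y hxy
    rcases le_or_gt r |x| with h | h
    · rw [hκ x h, zero_mul]
    · rw [hχ y (by linarith), mul_zero]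
  have hsame : ∀ x : ℝ, (𝓕 κ : 𝓢(ℝ, ℂ)) (x + η) * (𝓕 χ : 𝓢(ℝ, ℂ)) (x + η') = 0 := fun x => by
    refine hprod _ _ (le_trans (le_of_eq ?_) (abs_sub (x + η) (x + η')))
    congr 1
    ring
  have hrefl : ∀ x : ℝ, (𝓕 κ : 𝓢(ℝ, ℂ)) (x + η) * (𝓕 χ : 𝓢(ℝ, ℂ)) (-x + η') = 0 := fun x => by
    refine hprod _ _ (le_trans ?_ (abs_add_le (x + η) (-x + η')))
    rw [show x + η + (-x + η') = η + η' by ring, abs_of_pos (add_pos hη hη')]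
    exact abs_le.2 ⟨by linarith, by linarith⟩
  -- The differentiated window has as transform a multiple of the original one, so the same
  -- separation covers all four pairs.
  have hmul : ∀ {κ : 𝓢(ℝ, ℂ)} (η : ℝ) (i : Fin 2), ∃ c : ℝ → ℂ, ∀ x,
      (𝓕 (![shift κ t η, shift (SchwartzMap.derivCLM ℂ ℂ κ) t η] i) : 𝓢(ℝ, ℂ)) x =
        c x * (𝓕 κ : 𝓢(ℝ, ℂ)) (x + η) := by
    intro κ η i
    fin_cases i
    · exact ⟨_, fun x => fourier_shift κ t η x⟩
    · refine ⟨fun x => Complex.exp (-2 * Real.pi * Complex.I * x * t) *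
        (2 * Real.pi * Complex.I * (x + η : ℝ)), fun x => (fourier_shift _ t η x).trans ?_⟩
      rw [fourier_derivCLM, ← mul_assoc]
  have hind := hΦ.indepFun_pair
    (φ := ![shift κ t η, shift (SchwartzMap.derivCLM ℂ ℂ κ) t η])
    (χ := ![shift χ t η', shift (SchwartzMap.derivCLM ℂ ℂ χ) t η'])
    (fun i j x => by
      obtain ⟨c, hc⟩ := hmul (κ := κ) η i
      obtain ⟨d, hd⟩ := hmul (κ := χ) η' j
      rw [hc, hd, mul_mul_mul_comm, hsame, mul_zero])
    (fun i j x => by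
      obtain ⟨c, hc⟩ := hmul (κ := κ) η i
      obtain ⟨d, hd⟩ := hmul (κ := χ) η' j
      rw [hc, hd, mul_mul_mul_comm, hrefl, mul_zero])
  have hmeas : ∀ (κ : 𝓢(ℝ, ℂ)) (η : ℝ), Measurable fun p : ℂ × ℂ => profile (ξ - η) α
      ((∫ s : ℝ, f s * shift κ t η s) + p.1) (-(1 / (2 * Real.pi * Complex.I)) *
        ((∫ s : ℝ, f s * shift (SchwartzMap.derivCLM ℂ ℂ κ) t η s) + p.2)) := fun κ η =>
    (measurable_profile (ξ - η) α).comp (g := fun p : ℂ × ℂ => profile (ξ - η) α p.1 p.2)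
      (f := fun p : ℂ × ℂ => ((∫ s : ℝ, f s * shift κ t η s) + p.1,
        -(1 / (2 * Real.pi * Complex.I)) *
          ((∫ s : ℝ, f s * shift (SchwartzMap.derivCLM ℂ ℂ κ) t η s) + p.2))) (by fun_prop)
  exact hind.comp (hmeas κ η) (hmeas χ η')

/-- The integrands at distinct frequencies decorrelate at a Gaussian rate. -/
theorem norm_complexCov_sstVersion_le (hΦ : IsComplexGaussianWhiteNoise Φ P) {A : ℝ}
    (hA : 0 ≤ A) (ξ₀ ξ t : ℝ) {η η' : ℝ} (hη : 0 < η) (hη' : 0 < η') (hne : η ≠ η')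
    {α : ℝ} (hα : 0 < α) (hα1 : α ≤ 1) {κ χ : 𝓢(ℝ, ℂ)}
    (hκ : ∀ x, ‖(𝓕 κ : 𝓢(ℝ, ℂ)) x‖ ≤ Real.exp (-(19 * x ^ 2)))
    (hχ : ∀ x, ‖(𝓕 χ : 𝓢(ℝ, ℂ)) x‖ ≤ Real.exp (-(19 * x ^ 2))) :
    ‖complexCov (sstVersion (signal A ξ₀) Φ κ α ξ t η) (sstVersion (signal A ξ₀) Φ χ α ξ t η') P‖
      ≤ 4 * momentConst A ^ 2 * (α ^ 3)⁻¹ *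
        ((1 + |η - η'|) * Real.exp (-(2 * (η - η') ^ 2))) := by
  have hΔ : 0 < |η - η'| := abs_pos.2 (sub_ne_zero.2 hne)
  -- The outer radius gives exact separation; the inner one gives the error exponent `18 / 3² = 2`.
  let b : ContDiffBump (0 : ℝ) := ⟨|η - η'| / 3, |η - η'| / 2, by positivity, by linarith⟩
  have hb := contDiffBump_hasTemperateGrowth b
  have hb1 : ∀ x, |x| ≤ |η - η'| / 3 → b x = 1 := fun x hx =>
    b.one_of_mem_closedBall (by rwa [mem_closedBall_zero_iff])
  have hb0 : ∀ x, |η - η'| / 2 ≤ |x| → b x = 0 := fun x hx =>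
    b.zero_of_le_dist (by rwa [dist_zero_right])
  have hsupp : ∀ (κ : 𝓢(ℝ, ℂ)) x, |η - η'| / 2 ≤ |x| →
      (𝓕 (truncatedWindow b κ) : 𝓢(ℝ, ℂ)) x = 0 := fun κ x hx => by
    rw [fourier_truncatedWindow_of_hasTemperateGrowth hb, hb0 x hx, Complex.ofReal_zero, zero_mul]
  have hε : Real.exp (-(18 * (|η - η'| / 3) ^ 2)) = Real.exp (-(2 * (η - η') ^ 2)) := by
    rw [div_pow, sq_abs]
    congr 1
    ring
  have htail : ∀ {κ : 𝓢(ℝ, ℂ)}, (∀ x, ‖(𝓕 κ : 𝓢(ℝ, ℂ)) x‖ ≤ Real.exp (-(19 * x ^ 2))) → ∀ x,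
      ‖(𝓕 (κ - truncatedWindow b κ) : 𝓢(ℝ, ℂ)) x‖ ≤
        Real.exp (-(2 * (η - η') ^ 2)) * Real.exp (-x ^ 2) := fun hκ => by
    rw [← hε]
    exact norm_fourier_sub_truncatedWindow_le (by positivity) hb (fun _ => b.nonneg)
      (fun _ => b.le_one) hb1 hκ
  have hdom : ∀ {κ : 𝓢(ℝ, ℂ)}, (∀ x, ‖(𝓕 κ : 𝓢(ℝ, ℂ)) x‖ ≤ Real.exp (-(19 * x ^ 2))) → ∀ x,
      ‖(𝓕 κ : 𝓢(ℝ, ℂ)) x‖ ≤ Real.exp (-x ^ 2) := fun hκ x => (hκ x).trans (by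
    gcongr
    linarith [sq_nonneg x])
  have hmem : ∀ (κ : 𝓢(ℝ, ℂ)) (η : ℝ), MemLp (sstVersion (signal A ξ₀) Φ κ α ξ t η) 2 P :=
    fun κ η => memLp_sstVersion hΦ _ κ hα hα1 ξ t η
  set S := fun κ η => sstVersion (signal A ξ₀) Φ κ α ξ t η with hS
  -- The windows are truncated one at a time: `κ` against `χ`, then `χ` against the truncated `κ`
  -- with the slots swapped by conjugation. What remains is zero by independence.
  have h1 := norm_complexCov_sstVersion_sub_le hΦ hA ξ₀ ξ t η η' hα hα1 (Real.exp_pos _)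
    (htail hκ) (hdom hχ)
  have h2 := norm_complexCov_sstVersion_sub_le hΦ hA ξ₀ ξ t η' η hα hα1 (Real.exp_pos _)
    (htail hχ) (χ := truncatedWindow b κ) fun x =>
      (norm_fourier_truncatedWindow_le hb (fun _ => b.nonneg) (fun _ => b.le_one) x).trans
        (hdom hκ x)
  have h3 : complexCov (S (truncatedWindow b χ) η') (S (truncatedWindow b κ) η) P = 0 :=
    complexCov_eq_zero_of_indepFun (hmem _ _) (hmem _ _)
      (indepFun_sstVersion hΦ _ α ξ t hη hη' (by linarith) (hsupp κ) (hsupp χ)).symm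
  rw [complexCov_sub_left (hmem _ _) (hmem _ _) (hmem _ _)] at h1 h2
  rw [abs_sub_comm η' η] at h2
  change ‖complexCov (S χ η') (S (truncatedWindow b κ) η) P -
    complexCov (S (truncatedWindow b χ) η') (S (truncatedWindow b κ) η) P‖ ≤ _ at h2
  rw [h3, sub_zero, ← conj_complexCov, RCLike.norm_conj] at h2
  have h4 := norm_le_norm_sub_add (complexCov (S κ η) (S χ η') P)
    (complexCov (S (truncatedWindow b κ) η) (S χ η') P)
  change ‖complexCov (S κ η) (S χ η') P‖ ≤ _
  calc _ ≤ _ := h4.trans (add_le_add h1 h2)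
    _ = _ := by ring

end Profile

/-! ### The Gaussian window and its truncations -/

theorem norm_fourier_gaussianWindow_le (x : ℝ) :
    ‖(𝓕 gaussianWindow : 𝓢(ℝ, ℂ)) x‖ ≤ Real.exp (-(19 * x ^ 2)) := by
  rw [fourier_gaussianWindow, Complex.norm_real, Real.norm_of_nonneg (Real.exp_pos _).le]
  gcongr
  nlinarith [Real.pi_gt_d2]

theorem IsCutoff.mem_Icc {M : ℝ} {ψ : ℝ → ℝ} (hψ : IsCutoff M ψ) (hM : 0 < M) (x : ℝ) :
    0 ≤ ψ x ∧ ψ x ≤ 1 := by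
  have hpos : ∀ x, 0 ≤ x → 0 ≤ ψ x ∧ ψ x ≤ 1 := by
    intro x hx
    have hM1 : ψ M = 1 := hψ.eq_one M (by rw [abs_of_pos hM])
    -- The cutoff is prescribed to vanish only strictly beyond `2M`; the endpoint follows by
    -- continuity.
    have h2M : ψ (2 * M) = 0 := by
      have hev : Tendsto ψ (𝓝[>] (2 * M)) (𝓝 0) :=
        tendsto_const_nhds.congr' (eventually_mem_nhdsWithin.mono fun y hy =>
          (hψ.eq_zero y (lt_of_lt_of_le hy (le_abs_self y))).symm)
      exact tendsto_nhds_unique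
        (hψ.contDiff.continuous.continuousAt.tendsto.mono_left nhdsWithin_le_nhds) hev
    rcases le_or_gt x M with h | h
    · rw [hψ.eq_one x (by rwa [abs_of_nonneg hx])]
      norm_num
    rcases le_or_gt x (2 * M) with h' | h'
    · constructor
      · rw [← h2M]
        exact hψ.antitoneOn ⟨h.le, h'⟩ ⟨by linarith, le_rfl⟩ h'
      · rw [← hM1]
        exact hψ.antitoneOn ⟨le_rfl, by linarith⟩ ⟨h.le, h'⟩ h.le
    · rw [hψ.eq_zero x (lt_of_lt_of_le h' (le_abs_self x))]
      norm_num
  rcases le_total 0 x with h | h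
  · exact hpos x h
  · rw [← hψ.even x]
    exact hpos (-x) (by linarith)

/-- The factor `1 + |Δ|` costs `e^{Δ²}`, and `Δ² - 18M² ≤ -Δ² - 3M²` is exactly the hypothesis. -/
theorem exp_interpolation_left {M Δ : ℝ} (h : 2 * Δ ^ 2 ≤ 15 * M ^ 2) :
    (1 + |Δ|) * Real.exp (-(18 * M ^ 2)) ≤ 2 * Real.exp (-Δ ^ 2) * Real.exp (-3 * M ^ 2) := by
  have h1 : 1 + |Δ| ≤ 2 * Real.exp (Δ ^ 2) := by
    have := Real.add_one_le_exp (Δ ^ 2)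
    nlinarith [sq_nonneg (|Δ| - 1), sq_abs Δ]
  calc _ ≤ 2 * Real.exp (Δ ^ 2) * Real.exp (-(18 * M ^ 2)) := by gcongr
    _ = 2 * Real.exp (Δ ^ 2 + -(18 * M ^ 2)) := by rw [Real.exp_add]; ring
    _ ≤ 2 * Real.exp (-Δ ^ 2 + -3 * M ^ 2) :=
        mul_le_mul_of_nonneg_left (Real.exp_le_exp.2 (by linarith)) zero_le_two
    _ = _ := by rw [Real.exp_add]; ring

theorem exp_interpolation_right {M Δ : ℝ} (h : 15 * M ^ 2 ≤ 2 * Δ ^ 2) :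
    (1 + |Δ|) * Real.exp (-(2 * Δ ^ 2)) ≤ 2 * Real.exp (-Δ ^ 2) * Real.exp (-3 * M ^ 2) := by
  -- With `3/5`, the remaining requirement `3M² ≤ (2/5)Δ²` is the complementary threshold.
  have h1 : 1 + |Δ| ≤ 2 * Real.exp (3 / 5 * Δ ^ 2) := by
    have := Real.add_one_le_exp (3 / 5 * Δ ^ 2)
    nlinarith [sq_nonneg (|Δ| - 1), sq_abs Δ]
  calc _ ≤ 2 * Real.exp (3 / 5 * Δ ^ 2) * Real.exp (-(2 * Δ ^ 2)) := by gcongr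
    _ = 2 * Real.exp (3 / 5 * Δ ^ 2 + -(2 * Δ ^ 2)) := by rw [Real.exp_add]; ring
    _ ≤ 2 * Real.exp (-Δ ^ 2 + -3 * M ^ 2) :=
        mul_le_mul_of_nonneg_left (Real.exp_le_exp.2 (by linarith)) zero_le_two
    _ = _ := by rw [Real.exp_add]; ring

section Comparison

variable {Ω : Type*} [MeasurableSpace Ω] {P : Measure Ω} [IsProbabilityMeasure P]
  {Φ : 𝓢(ℝ, ℂ) → Ω → ℂ}

/-- Replacing one window in a covariance at separated frequencies. -/
theorem norm_complexCov_sub_complexCov_le (hΦ : IsComplexGaussianWhiteNoise Φ P) {A : ℝ}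
    (hA : 0 ≤ A) (ξ₀ ξ t : ℝ) {η η' M : ℝ} (hη : 0 < η) (hη' : 0 < η') (hne : η ≠ η')
    {α : ℝ} (hα : 0 < α) (hα1 : α ≤ 1) {κ κ' χ : 𝓢(ℝ, ℂ)}
    (hκ : ∀ x, ‖(𝓕 κ : 𝓢(ℝ, ℂ)) x‖ ≤ Real.exp (-(19 * x ^ 2)))
    (hκ' : ∀ x, ‖(𝓕 κ' : 𝓢(ℝ, ℂ)) x‖ ≤ Real.exp (-(19 * x ^ 2)))
    (hχ : ∀ x, ‖(𝓕 χ : 𝓢(ℝ, ℂ)) x‖ ≤ Real.exp (-(19 * x ^ 2)))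
    (hsub : ∀ x, ‖(𝓕 (κ - κ') : 𝓢(ℝ, ℂ)) x‖ ≤
      Real.exp (-(18 * M ^ 2)) * Real.exp (-x ^ 2)) :
    ‖complexCov (sstVersion (signal A ξ₀) Φ κ α ξ t η)
          (sstVersion (signal A ξ₀) Φ χ α ξ t η') P -
        complexCov (sstVersion (signal A ξ₀) Φ κ' α ξ t η)
          (sstVersion (signal A ξ₀) Φ χ α ξ t η') P‖ ≤
      16 * momentConst A ^ 2 * Real.exp (-(η - η') ^ 2) *
        ((α ^ 3)⁻¹ * Real.exp (-3 * M ^ 2)) := by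
  have hc := momentConst_pos A
  rcases le_total (2 * (η - η') ^ 2) (15 * M ^ 2) with h | h
  · have h1 := norm_complexCov_sstVersion_sub_le hΦ hA ξ₀ ξ t η η' hα hα1 (Real.exp_pos _) hsub
      (χ := χ) fun x => (hχ x).trans (by gcongr; linarith [sq_nonneg x])
    rw [complexCov_sub_left (memLp_sstVersion hΦ _ _ hα hα1 ξ t η)
      (memLp_sstVersion hΦ _ _ hα hα1 ξ t η) (memLp_sstVersion hΦ _ _ hα hα1 ξ t η')] at h1
    calc _ ≤ _ := h1
      _ ≤ 2 * momentConst A ^ 2 * (α ^ 3)⁻¹ *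
          (2 * Real.exp (-(η - η') ^ 2) * Real.exp (-3 * M ^ 2)) :=
          mul_le_mul_of_nonneg_left (exp_interpolation_left h) (by positivity)
      _ = 4 * (momentConst A ^ 2 * Real.exp (-(η - η') ^ 2) *
          ((α ^ 3)⁻¹ * Real.exp (-3 * M ^ 2))) := by ring
      _ ≤ 16 * (momentConst A ^ 2 * Real.exp (-(η - η') ^ 2) *
          ((α ^ 3)⁻¹ * Real.exp (-3 * M ^ 2))) := by gcongr; norm_num
      _ = _ := by ring
  · have h1 := norm_complexCov_sstVersion_le hΦ hA ξ₀ ξ t hη hη' hne hα hα1 hκ hχ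
    have h2 := norm_complexCov_sstVersion_le hΦ hA ξ₀ ξ t hη hη' hne hα hα1 hκ' hχ
    have h3 := mul_le_mul_of_nonneg_left (exp_interpolation_right h)
      (by positivity : 0 ≤ 8 * momentConst A ^ 2 * (α ^ 3)⁻¹)
    calc _ ≤ _ := (norm_sub_le _ _).trans (add_le_add h1 h2)
      _ = 8 * momentConst A ^ 2 * (α ^ 3)⁻¹ *
          ((1 + |η - η'|) * Real.exp (-(2 * (η - η') ^ 2))) := by ring
      _ ≤ _ := h3
      _ = _ := by ring

end Comparison

end SST

/-! ### Assembly of the main lemma with explicit constants -/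

theorem mainTheorem9 (A ξ₀ ξ : ℝ) (hA : 0 ≤ A) (hξ₀ : 0 < ξ₀) (hξ : 0 < ξ) :
    ∃ (α₀ M₀ R : ℝ) (C : ℝ → ℝ) (K : ℝ → ℝ → ℝ), 0 < α₀ ∧ 0 < M₀ ∧ 0 < R ∧
      -- the constant for the variances is `O(η^{-1/2})` as `η → 0`
      C =O[𝓝[>] (0 : ℝ)] (fun η : ℝ => η ^ (-(1 / 2) : ℝ)) ∧
      -- the constant for the covariances: `η` and `η'` away from `0`
      (∀ δ : ℝ, 0 < δ → ∃ c : ℝ, ∀ η η' : ℝ, δ ≤ η → δ ≤ η' → R ≤ |η - η'| →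
        |K η η'| ≤ c * Real.exp (-(η - η') ^ 2)) ∧
      -- small `η`
      (∃ δ c : ℝ, 0 < δ ∧ ∀ η η' : ℝ, 0 < η → η < δ → 0 < η' → R ≤ |η - η'| →
        |K η η'| ≤ c * η ^ (-(1 / 2) : ℝ) * Real.exp (-(η - η') ^ 2)) ∧
      -- small `η'`
      (∃ δ c : ℝ, 0 < δ ∧ ∀ η η' : ℝ, 0 < η → 0 < η' → η' < δ → R ≤ |η - η'| →
        |K η η'| ≤ c * η' ^ (-(1 / 2) : ℝ) * Real.exp (-(η - η') ^ 2)) ∧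
      ∀ {Ω : Type*} [MeasurableSpace Ω] (P : Measure Ω) [IsProbabilityMeasure P]
        (Φ : 𝓢(ℝ, ℂ) → Ω → ℂ), SST.IsComplexGaussianWhiteNoise Φ P →
      ∀ (t α M : ℝ) (ψ : ℝ → ℝ), 0 < α → α ≤ α₀ → M₀ ≤ M → SST.IsCutoff M ψ →
        (∀ η : ℝ, 0 < η → MemLp (SST.Y A ξ₀ Φ ξ t α η) 2 P ∧
          MemLp (SST.Ytrunc ψ A ξ₀ Φ ξ t α η) 2 P) ∧
        (∀ η : ℝ, 0 < η →
          ‖(SST.complexVar (SST.Y A ξ₀ Φ ξ t α η) P : ℂ) -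
              SST.complexCov (SST.Y A ξ₀ Φ ξ t α η) (SST.Ytrunc ψ A ξ₀ Φ ξ t α η) P‖
            ≤ C η * (α ^ (-5 : ℤ) * Real.exp (-3 * M ^ 2)) ∧
          ‖(SST.complexVar (SST.Ytrunc ψ A ξ₀ Φ ξ t α η) P : ℂ) -
              SST.complexCov (SST.Ytrunc ψ A ξ₀ Φ ξ t α η) (SST.Y A ξ₀ Φ ξ t α η) P‖
            ≤ C η * (α ^ (-5 : ℤ) * Real.exp (-3 * M ^ 2))) ∧
        (∀ η η' : ℝ, 0 < η → 0 < η' → R ≤ |η - η'| →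
          ‖SST.complexCov (SST.Y A ξ₀ Φ ξ t α η) (SST.Y A ξ₀ Φ ξ t α η') P -
              SST.complexCov (SST.Ytrunc ψ A ξ₀ Φ ξ t α η) (SST.Y A ξ₀ Φ ξ t α η') P‖
            ≤ K η η' * (α ^ (-5 : ℤ) * Real.exp (-3 * M ^ 2)) ∧
          ‖SST.complexCov (SST.Ytrunc ψ A ξ₀ Φ ξ t α η) (SST.Ytrunc ψ A ξ₀ Φ ξ t α η') P -
              SST.complexCov (SST.Y A ξ₀ Φ ξ t α η) (SST.Ytrunc ψ A ξ₀ Φ ξ t α η') P‖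
            ≤ K η η' * (α ^ (-5 : ℤ) * Real.exp (-3 * M ^ 2))) := by
  have hc := SST.momentConst_pos A
  set B : ℝ := 16 * SST.momentConst A ^ 2 with hB
  have hB0 : 0 < B := by positivity
  have hrpow : ∀ η : ℝ, 0 < η → η < 1 → 1 ≤ η ^ (-(1 / 2) : ℝ) := fun η h0 h1 =>
    Real.one_le_rpow_of_pos_of_le_one_of_nonpos h0 h1.le (by norm_num)
  have hK : ∀ η η' : ℝ, |B * Real.exp (-(η - η') ^ 2)| = B * Real.exp (-(η - η') ^ 2) :=
    fun η η' => abs_of_pos (by positivity)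
  -- No singularity at zero frequency arises: the bounds are uniform in `η`, and `1 ≤ η^{-1/2}` on
  -- `(0, 1)`. The value `R = 1` serves only to force `η ≠ η'`.
  refine ⟨1, 1, 1, fun _ => B, fun η η' => B * Real.exp (-(η - η') ^ 2), one_pos, one_pos,
    one_pos, ?_, fun δ _ => ⟨B, fun η η' _ _ _ => (hK η η').le⟩,
    ⟨1, B, one_pos, fun η η' h0 h1 _ _ => ?_⟩, ⟨1, B, one_pos, fun η η' _ h0 h1 _ => ?_⟩, ?_⟩
  · refine IsBigO.of_bound B ?_
    filter_upwards [Ioo_mem_nhdsGT (one_pos : (0 : ℝ) < 1)] with η hη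
    rw [Real.norm_of_nonneg hB0.le, Real.norm_of_nonneg (Real.rpow_nonneg hη.1.le _)]
    exact le_mul_of_one_le_right hB0.le (hrpow η hη.1 hη.2)
  · rw [hK]
    gcongr
    exact le_mul_of_one_le_right hB0.le (hrpow η h0 h1)
  · rw [hK]
    gcongr
    exact le_mul_of_one_le_right hB0.le (hrpow η' h0 h1)
  intro Ω _ P _ Φ hΦ t α M ψ hα hα1 hM hψ
  have hM0 : 0 < M := one_pos.trans_le hM
  set h := SST.gaussianWindow
  set h' := SST.truncatedWindow ψ h with hh'
  have hh : ∀ x, ‖(𝓕 h : 𝓢(ℝ, ℂ)) x‖ ≤ Real.exp (-(19 * x ^ 2)) :=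
    SST.norm_fourier_gaussianWindow_le
  have hht : ∀ x, ‖(𝓕 h' : 𝓢(ℝ, ℂ)) x‖ ≤ Real.exp (-(19 * x ^ 2)) := fun x =>
    (SST.norm_fourier_truncatedWindow_le hψ.hasTemperateGrowth (fun x => (hψ.mem_Icc hM0 x).1)
      (fun x => (hψ.mem_Icc hM0 x).2) x).trans (hh x)
  have hsub : ∀ x, ‖(𝓕 (h - h') : 𝓢(ℝ, ℂ)) x‖ ≤
      Real.exp (-(18 * M ^ 2)) * Real.exp (-x ^ 2) :=
    SST.norm_fourier_sub_truncatedWindow_le hM0.le hψ.hasTemperateGrowth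
      (fun x => (hψ.mem_Icc hM0 x).1) (fun x => (hψ.mem_Icc hM0 x).2) hψ.eq_one hh
  have hsub' : ∀ x, ‖(𝓕 (h' - h) : 𝓢(ℝ, ℂ)) x‖ ≤
      Real.exp (-(18 * M ^ 2)) * Real.exp (-x ^ 2) := fun x => by
    rw [← neg_sub h h', FourierTransform.fourier_neg, _root_.neg_apply, norm_neg]
    exact hsub x
  have hY : ∀ η, SST.Y A ξ₀ Φ ξ t α η =ᵐ[P] SST.sstVersion (SST.signal A ξ₀) Φ h α ξ t η :=
    fun η => SST.sstIntegrand_ae_eq hΦ A ξ₀ h α ξ t η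
  have hYt : ∀ η, SST.Ytrunc ψ A ξ₀ Φ ξ t α η =ᵐ[P]
      SST.sstVersion (SST.signal A ξ₀) Φ h' α ξ t η :=
    fun η => SST.sstIntegrand_ae_eq hΦ A ξ₀ h' α ξ t η
  have hmem : ∀ κ η, MemLp (SST.sstVersion (SST.signal A ξ₀) Φ κ α ξ t η) 2 P :=
    fun κ η => SST.memLp_sstVersion hΦ _ κ hα hα1 ξ t η
  -- The argument loses only `α⁻³`: `α⁻²` from the Lipschitz bound and `α⁻¹` from the size bound.
  have hpow : (α ^ 3)⁻¹ ≤ α ^ (-5 : ℤ) := by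
    rw [zpow_neg]
    have : α ^ (5 : ℤ) ≤ α ^ 3 := by
      exact_mod_cast pow_le_pow_of_le_one hα.le hα1 (by norm_num : 3 ≤ 5)
    exact inv_anti₀ (by positivity) this
  have hdom : ∀ {κ : 𝓢(ℝ, ℂ)}, (∀ x, ‖(𝓕 κ : 𝓢(ℝ, ℂ)) x‖ ≤ Real.exp (-(19 * x ^ 2))) → ∀ x,
      ‖(𝓕 κ : 𝓢(ℝ, ℂ)) x‖ ≤ Real.exp (-x ^ 2) := fun hκ x => (hκ x).trans (by
    gcongr
    linarith [sq_nonneg x])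
  have hvar : ∀ (η : ℝ) {κ κ' : 𝓢(ℝ, ℂ)},
      (∀ x, ‖(𝓕 κ : 𝓢(ℝ, ℂ)) x‖ ≤ Real.exp (-(19 * x ^ 2))) →
      (∀ x, ‖(𝓕 (κ - κ') : 𝓢(ℝ, ℂ)) x‖ ≤ Real.exp (-(18 * M ^ 2)) * Real.exp (-x ^ 2)) →
      ‖SST.complexCov (SST.sstVersion (SST.signal A ξ₀) Φ κ α ξ t η)
          (SST.sstVersion (SST.signal A ξ₀) Φ κ α ξ t η) P -
        SST.complexCov (SST.sstVersion (SST.signal A ξ₀) Φ κ α ξ t η)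
          (SST.sstVersion (SST.signal A ξ₀) Φ κ' α ξ t η) P‖ ≤
        B * (α ^ (-5 : ℤ) * Real.exp (-3 * M ^ 2)) := by
    intro η κ κ' hκ hκκ'
    have h1 := SST.norm_complexCov_sstVersion_sub_le hΦ hA ξ₀ ξ t η η hα hα1 (Real.exp_pos _)
      hκκ' (hdom hκ)
    rw [SST.complexCov_sub_left (hmem _ _) (hmem _ _) (hmem _ _), sub_self, abs_zero, add_zero,
      one_mul] at h1
    -- Here the window changes in the second slot, so conjugation moves it to the first.
    rw [← SST.conj_complexCov (SST.sstVersion (SST.signal A ξ₀) Φ κ' α ξ t η),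
      ← SST.conj_complexCov (SST.sstVersion (SST.signal A ξ₀) Φ κ α ξ t η)
        (SST.sstVersion (SST.signal A ξ₀) Φ κ α ξ t η), ← map_sub, RCLike.norm_conj]
    calc _ ≤ _ := h1
      _ ≤ B * α ^ (-5 : ℤ) * Real.exp (-3 * M ^ 2) := by
          gcongr
          · rw [hB]
            gcongr
            norm_num
          · nlinarith [sq_nonneg M]
      _ = _ := mul_assoc _ _ _
  have hcov : ∀ {η η' : ℝ} {κ κ' χ : 𝓢(ℝ, ℂ)}, 0 < η → 0 < η' → 1 ≤ |η - η'| →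
      (∀ x, ‖(𝓕 κ : 𝓢(ℝ, ℂ)) x‖ ≤ Real.exp (-(19 * x ^ 2))) →
      (∀ x, ‖(𝓕 κ' : 𝓢(ℝ, ℂ)) x‖ ≤ Real.exp (-(19 * x ^ 2))) →
      (∀ x, ‖(𝓕 χ : 𝓢(ℝ, ℂ)) x‖ ≤ Real.exp (-(19 * x ^ 2))) →
      (∀ x, ‖(𝓕 (κ - κ') : 𝓢(ℝ, ℂ)) x‖ ≤ Real.exp (-(18 * M ^ 2)) * Real.exp (-x ^ 2)) →
      ‖SST.complexCov (SST.sstVersion (SST.signal A ξ₀) Φ κ α ξ t η)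
          (SST.sstVersion (SST.signal A ξ₀) Φ χ α ξ t η') P -
        SST.complexCov (SST.sstVersion (SST.signal A ξ₀) Φ κ' α ξ t η)
          (SST.sstVersion (SST.signal A ξ₀) Φ χ α ξ t η') P‖ ≤
        B * Real.exp (-(η - η') ^ 2) * (α ^ (-5 : ℤ) * Real.exp (-3 * M ^ 2)) := by
    intro η η' κ κ' χ hη hη' hR hκ hκ' hχ hκκ'
    have hne : η ≠ η' := by
      rintro rfl
      norm_num at hR
    refine (SST.norm_complexCov_sub_complexCov_le hΦ hA ξ₀ ξ t hη hη' hne hα hα1 hκ hκ' hχ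
      hκκ').trans ?_
    gcongr
  refine ⟨fun η _ => ⟨(memLp_congr_ae (hY η)).2 (hmem _ _), (memLp_congr_ae (hYt η)).2 (hmem _ _)⟩,
    fun η _ => ?_, fun η η' hη hη' hR => ?_⟩
  · rw [SST.complexVar_eq_complexCov, SST.complexVar_eq_complexCov,
      SST.complexCov_congr (hY η) (hY η), SST.complexCov_congr (hY η) (hYt η),
      SST.complexCov_congr (hYt η) (hYt η), SST.complexCov_congr (hYt η) (hY η)]
    exact ⟨hvar η hh hsub, hvar η hht hsub'⟩
  · rw [SST.complexCov_congr (hY η) (hY η'), SST.complexCov_congr (hYt η) (hY η'),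
      SST.complexCov_congr (hYt η) (hYt η'), SST.complexCov_congr (hY η) (hYt η')]
    exact ⟨hcov hη hη' hR hh hht hh hsub, hcov hη hη' hR hht hh hht hsub'⟩
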